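/- Let $a>0$ and let $m_1,m_2,m_3>0$, $M=m_1+m_2+m_3$. Consider the planar three-body problem $m_k\dot q_k=p_k$, $\dot p_k=\sum_{j\ne k}\frac{m_jm_k}{r_{jk}^{a+2}}(q_j-q_k)$ for $q_k\in\mathbb C\cong\mathbb R^2$, $r_{jk}=|q_j-q_k|>0$, with centre of mass $\sum m_kq_k=0$. Put $U=\frac1a\sum_{j<k}\frac{m_jm_k}{r_{jk}^a}$, $I=\sum m_k|q_k|^2$, $C=\sum q_k\wedge p_k$, $H=\frac12\sum|p_k|^2/m_k-U$, let $\mu=UI^{a/2}$ be the configurational measure, and, for solutions with constant $\mu$, let $B$ be the constant of the first integral $\frac12\dot I^2-4HI-4\mu I^{(2-a)/2}=-2B$. (i) Given values $I_0>0$, $C\in\mathbb R$ and $\beta>0$, there is $\delta>0$ such that there is no solution, on any open time interval around an initial time $t_0$, which has constant configurational measure, $I(q(t_0))=I_0$, angular momentum $C$, $B-C^2=\beta$, and an initial configuration within distance less than $\delta$ of a nondegenerate equilateral triangle $(e_1,e_2,e_3)$, that is, with $|q_k(t_0)-e_k|<\delta$ for $k=1,2,3$. (ii) For a configuration $Q$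 with $\sum m_kQ_k=0$, $I(Q)=1$, put $r_{jk}=|Q_j-Q_k|$, $\mu=U(Q)$, $\Delta=Q_1\wedge Q_2+Q_2\wedge Q_3+Q_3\wedge Q_1$, $G_k=\sum_{j\neq k}\frac{m_jm_k}{r_{jk}^{a+2}}(Q_j-Q_k)+a\mu m_kQ_k$, $\rho=\sqrt{\frac{m_1m_2m_3}{M}\sum_k|G_k|^2/m_k}$, $$f_1=(a+2)m_1m_2m_3\Delta^2\sum\frac{m_\ell}{r_{jk}^{a+4}}\Big(\frac1{r_{k\ell}^{a+2}}-\frac1{r_{\ell j}^{a+2}}\Big)^2,\qquad f_2=\frac{M}{m_1m_2m_3}\Big(2a\mu-\sum\frac{m_j+m_k}{r_{jk}^{a+2}}\Big),$$ the sums being over the cyclic permutations $(j,k,\ell)$ of $(1,2,3)$. Let $Q=Q(x,y)$ be the triangle $(-1,0),(1,0),(x,\sqrt3+y)$, translated and rescaled so that $\sum m_kQ_k=0$ and $I(Q)=1$; it is equilateral for $(x,y)=0$. Put $\sigma=m_1m_2+m_2m_3+m_3m_1$ and $$D=m_1^2(x+\sqrt3y)^2+m_2^2(x-\sqrt3y)^2+4m_3^2x^2-m_1m_2(x^2-3y^2)+2m_2m_3x(x-\sqrt3y)+2m_3m_1x(x+\sqrt3y),$$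 $$N=m_1(x+\sqrt3y)^2+m_2(x-\sqrt3y)^2+4m_3x^2,\qquad L=\frac{3(a+2)\sigma^2}{4m_1m_2m_3}\Big(\frac{\sigma}{M}\Big)^{a/2}\frac{N}{D}.$$ Then the quadratic form $D$ is positive definite, and, as $(x,y)\to0$, $\rho^2=\big(\frac{(a+2)m_1m_2m_3}{4M}\big)^2\big(\frac{\sigma}{M}\big)^aD+o(x^2+y^2)$. The function $L$, which depends only on the direction of $(x,y)\ne0$, lies between two positive constants, and $\frac{f_1}{\rho^2}+f_2-L\to0$ as $(x,y)\to0$, $(x,y)\ne 0$; thus $\frac{f_1}{\rho^2}+f_2$ tends to a positive finite value along every direction of approach. For all $C\in\mathbb R$, $\beta>0$, $\epsilon=\pm1$, the quantity $$R=\frac{m_1^2m_2^2m_3^2}{M^2}\,\beta\Big(\frac{f_1}{\rho^4}+\frac{f_2}{\rho^2}\Big)+2\epsilon C\sqrt{\frac{m_1m_2m_3}{M}\beta}\;\frac1\rho$$ (the right-hand side of the key condition $-I^{(2-a)/2}=R$ with $\beta=B-C^2$) tends to $+\infty$ like $1/\rho^2$: $R\to+\infty$ and $\rho^2R-\frac{m_1^2m_2^2m_3^2}{M^2}\beta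 L\to0$ as $(x,y)\to0$, $(x,y)\ne0$. -/

import Mathlib

open Filter Topology Asymptotics

namespace ThreeBody

noncomputable section

/-- Outer product `a ∧ b = a_x b_y - a_y b_x` of planar vectors, written as complex numbers. -/
def wedge (z w : ℂ) : ℝ := z.re * w.im - z.im * w.re

/-- Total mass. -/
def totalMass (m : Fin 3 → ℝ) : ℝ := ∑ k, m k

/-- Moment of inertia `I = ∑ m_k |q_k|²`. -/
def inertia (m : Fin 3 → ℝ) (q : Fin 3 → ℂ) : ℝ := ∑ k, m k * ‖q k‖ ^ 2

/-- Side of the triangle opposite to the vertex `l` (index arithmetic is modulo 3, so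
`(l + 1, l + 2, l)` runs through the cyclic permutations of the three indices). -/
def side (q : Fin 3 → ℂ) (l : Fin 3) : ℝ := ‖q (l + 1) - q (l + 2)‖

/-- Potential `U = (1/a) ∑_{pairs} m_j m_k / r_{jk}^a`; each pair is listed once, as the pair
opposite to `l`. -/
def potential (a : ℝ) (m : Fin 3 → ℝ) (q : Fin 3 → ℂ) : ℝ :=
  (1 / a) * ∑ l, m (l + 1) * m (l + 2) / side q l ^ a

/-- Configurational measure `μ = U I^{a/2}`. -/
def confMeasure (a : ℝ) (m : Fin 3 → ℝ) (q : Fin 3 → ℂ) : ℝ :=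
  potential a m q * inertia m q ^ (a / 2)

/-- Force `g_k(q) = ∑_{j ≠ k} m_j m_k (q_j - q_k) / r_{jk}^{a+2}` on the body `k`. -/
def force (a : ℝ) (m : Fin 3 → ℝ) (q : Fin 3 → ℂ) (k : Fin 3) : ℂ :=
  ∑ j ∈ Finset.univ.erase k, ((m j * m k / ‖q j - q k‖ ^ (a + 2) : ℝ) : ℂ) * (q j - q k)

/-- Kinetic energy. -/
def kinetic (m : Fin 3 → ℝ) (p : Fin 3 → ℂ) : ℝ := (1 / 2) * ∑ k, ‖p k‖ ^ 2 / m k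

/-- Total energy `H = T - U`. -/
def energy (a : ℝ) (m : Fin 3 → ℝ) (q p : Fin 3 → ℂ) : ℝ := kinetic m p - potential a m q

/-- Angular momentum `C = ∑ q_k ∧ p_k`. -/
def angularMomentum (q p : Fin 3 → ℂ) : ℝ := ∑ k, wedge (q k) (p k)

/-- `q, p` is a collision-free solution on `J` of the planar three-body problem with potential `U`,
with centre of mass at the origin. -/
structure IsSolution (a : ℝ) (m : Fin 3 → ℝ) (J : Set ℝ) (q p : ℝ → Fin 3 → ℂ) : Prop where
  noCollision : ∀ t ∈ J, ∀ j k, j ≠ k → q t j ≠ q t k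
  centre : ∀ t ∈ J, ∑ k, (m k : ℂ) * q t k = 0
  hasDerivAt_q : ∀ t ∈ J, ∀ k, HasDerivAt (fun s => q s k) (p t k / (m k : ℂ)) t
  hasDerivAt_p : ∀ t ∈ J, ∀ k, HasDerivAt (fun s => p s k) (force a m (q t) k) t

/-- The constant `B` of the first integral
`(1/2) (dI/dt)² - 4 H I - 4 μ I^{(2-a)/2} = -2 B`, evaluated at the time `t`. -/
def constB (a : ℝ) (m : Fin 3 → ℝ) (q p : ℝ → Fin 3 → ℂ) (t : ℝ) : ℝ :=
  -(1 / 2) * ((1 / 2) * (deriv (fun s => inertia m (q s)) t) ^ 2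
    - 4 * energy a m (q t) (p t) * inertia m (q t)
    - 4 * confMeasure a m (q t) * inertia m (q t) ^ ((2 - a) / 2))

/-- Nondegenerate equilateral triangle (of any size, position and orientation). -/
def IsEquilateral (e : Fin 3 → ℂ) : Prop :=
  0 < side e 0 ∧ side e 0 = side e 1 ∧ side e 1 = side e 2

/-- The configuration `Q` obtained from `q` by moving the centre of mass to the origin and rescaling
to moment of inertia one. -/
def normalized (m : Fin 3 → ℝ) (q : Fin 3 → ℂ) (k : Fin 3) : ℂ :=
  let c : ℂ := (∑ j, (m j : ℂ) * q j) / (totalMass m : ℂ)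
  (q k - c) / (Real.sqrt (inertia m (fun j => q j - c)) : ℂ)

/-- `G_k(Q) = g_k(Q) + a μ m_k Q_k`. -/
def bigG (a : ℝ) (m : Fin 3 → ℝ) (Q : Fin 3 → ℂ) (k : Fin 3) : ℂ :=
  force a m Q k + ((a * confMeasure a m Q * m k : ℝ) : ℂ) * Q k

/-- `ρ = √((m₁m₂m₃/M) ∑ |G_k|²/m_k)`. -/
def rho (a : ℝ) (m : Fin 3 → ℝ) (Q : Fin 3 → ℂ) : ℝ :=
  Real.sqrt ((∏ k, m k) / totalMass m * ∑ k, ‖bigG a m Q k‖ ^ 2 / m k)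

/-- Twice the oriented area of the triangle. -/
def area2 (Q : Fin 3 → ℂ) : ℝ := ∑ l, wedge (Q l) (Q (l + 1))

/-- `f₁ = (a+2) m₁m₂m₃ Δ² ∑ (m_l / r_{jk}^{a+4}) (1/r_{kl}^{a+2} - 1/r_{lj}^{a+2})²`, summed over
the cyclic `(j, k, l) = (l + 1, l + 2, l)`. -/
def f₁ (a : ℝ) (m : Fin 3 → ℝ) (Q : Fin 3 → ℂ) : ℝ :=
  (a + 2) * (∏ k, m k) * area2 Q ^ 2 *
    ∑ l, m l / side Q l ^ (a + 4) *
      (1 / side Q (l + 1) ^ (a + 2) - 1 / side Q (l + 2) ^ (a + 2)) ^ 2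

/-- `f₂ = (M/(m₁m₂m₃)) (2aμ - ∑ (m_j + m_k) / r_{jk}^{a+2})`. -/
def f₂ (a : ℝ) (m : Fin 3 → ℝ) (Q : Fin 3 → ℂ) : ℝ :=
  totalMass m / (∏ k, m k) *
    (2 * a * confMeasure a m Q - ∑ l, (m (l + 1) + m (l + 2)) / side Q l ^ (a + 2))

/-- Right-hand side of the key condition, with `β = B - C²` and `ε = ±1`. -/
def keyRHS (a : ℝ) (m : Fin 3 → ℝ) (C β ε : ℝ) (Q : Fin 3 → ℂ) : ℝ :=
  (∏ k, m k) ^ 2 / totalMass m ^ 2 * β * (f₁ a m Q / rho a m Q ^ 4 + f₂ a m Q / rho a m Q ^ 2)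
    + 2 * ε * C * Real.sqrt ((∏ k, m k) / totalMass m * β) * (1 / rho a m Q)

/-- The normalized triangle with vertices proportional to `(-1, 0)`, `(1, 0)`, `(x, √3 + y)`, up to
translation; `z = (x, y)`. It is equilateral at `z = 0`. -/
def nearEquilateral (m : Fin 3 → ℝ) (z : ℝ × ℝ) : Fin 3 → ℂ :=
  normalized m ![-1, 1, ⟨z.1, Real.sqrt 3 + z.2⟩]

/-- `m₁m₂ + m₂m₃ + m₃m₁`. -/
def massPairs (m : Fin 3 → ℝ) : ℝ := ∑ l, m (l + 1) * m (l + 2)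

/-- The quadratic form in the leading term of `ρ²`. -/
def rhoForm (m : Fin 3 → ℝ) (z : ℝ × ℝ) : ℝ :=
  m 0 ^ 2 * (z.1 + Real.sqrt 3 * z.2) ^ 2 + m 1 ^ 2 * (z.1 - Real.sqrt 3 * z.2) ^ 2
    + 4 * m 2 ^ 2 * z.1 ^ 2 - m 0 * m 1 * (z.1 ^ 2 - 3 * z.2 ^ 2)
    + 2 * m 1 * m 2 * z.1 * (z.1 - Real.sqrt 3 * z.2)
    + 2 * m 2 * m 0 * z.1 * (z.1 + Real.sqrt 3 * z.2)

/-- The quadratic form in the leading term of `f₁`. -/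
def f₁Form (m : Fin 3 → ℝ) (z : ℝ × ℝ) : ℝ :=
  m 0 * (z.1 + Real.sqrt 3 * z.2) ^ 2 + m 1 * (z.1 - Real.sqrt 3 * z.2) ^ 2 + 4 * m 2 * z.1 ^ 2

/-- Limit of `f₁/ρ² + f₂` at the equilateral triangle along the direction `z ≠ 0`. It is homogeneous
of degree zero in `z`. -/
def dirLimit (a : ℝ) (m : Fin 3 → ℝ) (z : ℝ × ℝ) : ℝ :=
  3 * (a + 2) * massPairs m ^ 2 / (4 * ∏ k, m k) * (massPairs m / totalMass m) ^ (a / 2) *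
    (f₁Form m z / rhoForm m z)

end

end ThreeBody

set_option linter.unusedSimpArgs false

namespace ThreeBody

/-! Part (i) holds because, up to similarity, the equilateral triangle is a nondegenerate minimum of
the configurational measure. Split the velocity as `v = (r + iω) q + w`, with `w` centred and
orthogonal, for the mass inner product, to scaling and rotation of `q`. Then `I · inertia m w = B -
C²`, so `β > 0` fixes the size of `w`. If the measure is constant, its first two time derivatives
vanish. In the second one the acceleration contributes a nonnegative term, by Cauchy–Schwarz for the
position and the acceleration, so the second variation along `w` is nonpositive
(`secondVariation_nonpos`, `exists_isShapeVelocity`). At an equilateral triangle it is strictly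
positive for `w ≠ 0` (`secondVariation_pos`). With `I` and the size of `w` fixed, compactness
spreads this positivity to a uniform neighbourhood (`exists_no_constant_measure`).

Part (ii) is an expansion at the equilateral triangle. After normalization, `G_k` is a combination
of edges whose coefficients are deviations of the weights `1/r^{a+2}` from a mean (`bigG_eq`). Those
deviations and the differences of weights in `f₁` vanish to first order, so `ρ²` and `f₁` both have
quadratic leading terms (`hasLeadingTerm_rho_sq`, `hasLeadingTerm_f₁`), while `f₂` tends to zero
(`tendsto_f₂`). The two quadratic forms bound each other up to constants, so their quotient lies
between positive constants, and division by `ρ²` is harmless (`tendsto_sub_dirLimit`). In `ρ²R` the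
term with `C` carries a factor `ρ` and disappears, which leaves a positive multiple of the
directional limit. -/

/-- Euclidean inner product of planar vectors. -/
def dot (z w : ℂ) : ℝ := z.re * w.re + z.im * w.im

/-- Oriented side opposite to the vertex `l`. -/
def edge (q : Fin 3 → ℂ) (l : Fin 3) : ℂ := q (l + 1) - q (l + 2)

/-- Product of the masses at the ends of the side opposite to `l`. -/
def pairMass (m : Fin 3 → ℝ) (l : Fin 3) : ℝ := m (l + 1) * m (l + 2)

/-- The weight `1 / r^{a+2}` of the side opposite to `l`. -/
noncomputable def weight (a : ℝ) (q : Fin 3 → ℂ) (l : Fin 3) : ℝ := 1 / side q l ^ (a + 2)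

/-! ### Edges, weights and accelerations -/

lemma dot_self (z : ℂ) : dot z z = ‖z‖ ^ 2 := by
  rw [← Complex.normSq_eq_norm_sq, Complex.normSq_apply, dot]

lemma side_eq_norm_edge (q : Fin 3 → ℂ) (l : Fin 3) : side q l = ‖edge q l‖ := rfl

lemma side_sq (q : Fin 3 → ℂ) (l : Fin 3) : side q l ^ 2 = dot (edge q l) (edge q l) := by
  rw [dot_self, side_eq_norm_edge]

lemma side_nonneg (q : Fin 3 → ℂ) (l : Fin 3) : 0 ≤ side q l := norm_nonneg _

lemma pairMass_pos {m : Fin 3 → ℝ} (hm : ∀ k, 0 < m k) (l : Fin 3) : 0 < pairMass m l :=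
  mul_pos (hm _) (hm _)

lemma totalMass_pos {m : Fin 3 → ℝ} (hm : ∀ k, 0 < m k) : 0 < totalMass m :=
  Finset.sum_pos (fun k _ => hm k) Finset.univ_nonempty

lemma weight_pos {a : ℝ} {q : Fin 3 → ℂ} {l : Fin 3} (h : 0 < side q l) : 0 < weight a q l := by
  unfold weight; positivity

lemma re_centre {m : Fin 3 → ℝ} {q : Fin 3 → ℂ} (h : ∑ k, (m k : ℂ) * q k = 0) :
    ∑ k, m k * (q k).re = 0 := by
  simpa using congrArg Complex.re h

lemma im_centre {m : Fin 3 → ℝ} {q : Fin 3 → ℂ} (h : ∑ k, (m k : ℂ) * q k = 0) :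
    ∑ k, m k * (q k).im = 0 := by
  simpa using congrArg Complex.im h

/-- Lagrange's identity: the two sides differ by the inner product of the mass sums of `q` and `w`,
so it is enough that one of them is centred. -/
lemma totalMass_mul_sum_dot {m : Fin 3 → ℝ} {q : Fin 3 → ℂ} (h : ∑ k, (m k : ℂ) * q k = 0)
    (w : Fin 3 → ℂ) :
    totalMass m * ∑ k, m k * dot (q k) (w k)
      = ∑ l, pairMass m l * dot (edge q l) (edge w l) := by
  have hr := re_centre h
  have hi := im_centre h
  simp only [Fin.sum_univ_three, totalMass, pairMass, dot, edge, Complex.sub_re, Complex.sub_im,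
    Fin.reduceAdd] at *
  linear_combination (m 0 * (w 0).re + m 1 * (w 1).re + m 2 * (w 2).re) * hr
    + (m 0 * (w 0).im + m 1 * (w 1).im + m 2 * (w 2).im) * hi

lemma totalMass_mul_sum_wedge {m : Fin 3 → ℝ} {q : Fin 3 → ℂ} (h : ∑ k, (m k : ℂ) * q k = 0)
    (w : Fin 3 → ℂ) :
    totalMass m * ∑ k, m k * wedge (q k) (w k)
      = ∑ l, pairMass m l * wedge (edge q l) (edge w l) := by
  have hr := re_centre h
  have hi := im_centre h
  simp only [Fin.sum_univ_three, totalMass, pairMass, wedge, edge, Complex.sub_re, Complex.sub_im,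
    Fin.reduceAdd] at *
  linear_combination (m 0 * (w 0).im + m 1 * (w 1).im + m 2 * (w 2).im) * hr
    - (m 0 * (w 0).re + m 1 * (w 1).re + m 2 * (w 2).re) * hi

lemma inertia_eq_sum_dot (m : Fin 3 → ℝ) (q : Fin 3 → ℂ) :
    inertia m q = ∑ k, m k * dot (q k) (q k) := by
  simp only [inertia, dot_self]

lemma totalMass_mul_inertia {m : Fin 3 → ℝ} {q : Fin 3 → ℂ} (h : ∑ k, (m k : ℂ) * q k = 0) :
    totalMass m * inertia m q = ∑ l, pairMass m l * side q l ^ 2 := by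
  simp only [inertia_eq_sum_dot, totalMass_mul_sum_dot h, side_sq]

lemma inertia_pos {m : Fin 3 → ℝ} (hm : ∀ k, 0 < m k) {q : Fin 3 → ℂ}
    (h : ∑ k, (m k : ℂ) * q k = 0) (hs : ∀ l, 0 < side q l) : 0 < inertia m q := by
  have h1 : 0 < totalMass m * inertia m q := by
    rw [totalMass_mul_inertia h]
    exact Finset.sum_pos (fun l _ => mul_pos (pairMass_pos hm l) (pow_pos (hs l) 2))
      Finset.univ_nonempty
  exact (pos_iff_pos_of_mul_pos h1).1 (totalMass_pos hm)

lemma weight_mul_side_sq (a : ℝ) {q : Fin 3 → ℂ} {l : Fin 3} (h : 0 < side q l) :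
    weight a q l * side q l ^ 2 = 1 / side q l ^ a := by
  rw [weight, Real.rpow_add h, Real.rpow_two]
  field_simp

lemma mul_potential {a : ℝ} (ha : 0 < a) (m : Fin 3 → ℝ) {q : Fin 3 → ℂ}
    (hs : ∀ l, 0 < side q l) :
    a * potential a m q = ∑ l, pairMass m l * (weight a q l * side q l ^ 2) := by
  simp only [potential, weight_mul_side_sq a (hs _), pairMass]
  rw [← mul_assoc, mul_one_div_cancel ha.ne', one_mul]
  simp only [mul_one_div]

lemma force_eq (a : ℝ) (m : Fin 3 → ℝ) (q : Fin 3 → ℂ) (k : Fin 3) :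
    force a m q k = (m k : ℂ) * ((m (k + 2) * weight a q (k + 1) : ℝ) * edge q (k + 1)
      - (m (k + 1) * weight a q (k + 2) : ℝ) * edge q (k + 2)) := by
  have e0 : (Finset.univ.erase (0 : Fin 3)) = {1, 2} := by decide
  have e1 : (Finset.univ.erase (1 : Fin 3)) = {0, 2} := by decide
  have e2 : (Finset.univ.erase (2 : Fin 3)) = {0, 1} := by decide
  have h01 := norm_sub_rev (q 0) (q 1)
  have h02 := norm_sub_rev (q 0) (q 2)
  have h12 := norm_sub_rev (q 1) (q 2)
  fin_cases k
  · simp only [force, weight, side, edge, Fin.reduceFinMk, Fin.zero_eta, Fin.mk_one, Fin.reduceAdd,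
      zero_add, e0, Finset.sum_pair (show (1 : Fin 3) ≠ 2 by decide), h01]
    push_cast; ring
  · simp only [force, weight, side, edge, Fin.reduceFinMk, Fin.zero_eta, Fin.mk_one, Fin.reduceAdd,
      zero_add, e1, Finset.sum_pair (show (0 : Fin 3) ≠ 2 by decide), h12]
    push_cast; ring
  · simp only [force, weight, side, edge, Fin.reduceFinMk, Fin.zero_eta, Fin.mk_one, Fin.reduceAdd,
      zero_add, e2, Finset.sum_pair (show (0 : Fin 3) ≠ 1 by decide), ← h02]
    push_cast; ring

/-- Acceleration of the body `k`. -/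
noncomputable def accel (a : ℝ) (m : Fin 3 → ℝ) (q : Fin 3 → ℂ) (k : Fin 3) : ℂ :=
  (m (k + 2) * weight a q (k + 1) : ℝ) * edge q (k + 1)
      - (m (k + 1) * weight a q (k + 2) : ℝ) * edge q (k + 2)

/-- Internal forces sum to zero, so the Lagrange identity for `q` and its acceleration needs no
centring here. -/
lemma sum_pairMass_dot_accel (a : ℝ) (m : Fin 3 → ℝ) (q : Fin 3 → ℂ) :
    ∑ l, pairMass m l * dot (edge q l) (edge (accel a m q) l)
      = -totalMass m * ∑ l, pairMass m l * (weight a q l * side q l ^ 2) := by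
  simp only [side_sq]
  simp only [Fin.sum_univ_three, totalMass, pairMass, dot, edge, accel, Complex.sub_re,
    Complex.sub_im, Complex.re_ofReal_mul, Complex.im_ofReal_mul, Fin.reduceAdd, zero_add]
  ring

/-- Summation by parts: the left side is minus the derivative of the potential along `w`, and `m k *
accel k` is the force, which is the gradient of the potential. -/
lemma sum_pairMass_weight_dot (a : ℝ) (m : Fin 3 → ℝ) (q w : Fin 3 → ℂ) :
    ∑ l, pairMass m l * (weight a q l * dot (edge q l) (edge w l))
      = -∑ k, m k * dot (w k) (accel a m q k) := by
  simp only [Fin.sum_univ_three, pairMass, dot, edge, accel, Complex.sub_re,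
    Complex.sub_im, Complex.re_ofReal_mul, Complex.im_ofReal_mul, Fin.reduceAdd, zero_add]
  ring

/-- Cauchy–Schwarz in the mass inner product: by the summation by parts above, the sum being squared
is minus the product of `q` with its acceleration, and the last factor is the squared norm of the
acceleration. -/
lemma sq_sum_weight_le {a : ℝ} {m : Fin 3 → ℝ} (hm : ∀ k, 0 < m k) {q : Fin 3 → ℂ}
    (hI : 0 < inertia m q) :
    (∑ l, pairMass m l * (weight a q l * side q l ^ 2)) ^ 2
      ≤ inertia m q * -∑ l, pairMass m l *
          (weight a q l * dot (edge q l) (edge (accel a m q) l)) := by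
  have h1 := sum_pairMass_weight_dot a m q q
  simp only [← side_sq] at h1
  rw [sum_pairMass_weight_dot, h1, neg_neg, neg_sq]
  have hId := inertia_eq_sum_dot m q
  set b := ∑ k, m k * dot (q k) (accel a m q k) with hb
  set g := ∑ k, m k * dot (accel a m q k) (accel a m q k) with hg
  set i := inertia m q with hi
  -- This is the squared mass norm of `i · accel - b · q`; it equals `i (i g - b²)`, and `i > 0`.
  have h2 : 0 ≤ ∑ k, m k * ((i * (accel a m q k).re - b * (q k).re) ^ 2
      + (i * (accel a m q k).im - b * (q k).im) ^ 2) :=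
    Finset.sum_nonneg fun k _ => mul_nonneg (hm k).le (by positivity)
  have h3 : ∑ k, m k * ((i * (accel a m q k).re - b * (q k).re) ^ 2
      + (i * (accel a m q k).im - b * (q k).im) ^ 2)
      = i ^ 2 * g - 2 * i * b * b + b ^ 2 * i := by
    conv_rhs => rw [hg]; enter [2, 2]; rw [hId]
    conv_rhs => enter [1, 2, 2]; rw [hb]
    simp only [Fin.sum_univ_three, dot]
    ring
  rw [h3] at h2
  by_contra! h
  nlinarith

/-! ### Time derivatives of the potential, the inertia and the measure -/

lemma _root_.HasDerivAt.threeBody_dot {z w : ℝ → ℂ} {z' w' : ℂ} {t : ℝ} (hz : HasDerivAt z z' t)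
    (hw : HasDerivAt w w' t) :
    HasDerivAt (fun s => dot (z s) (w s)) (dot z' (w t) + dot (z t) w') t := by
  have re : ∀ {f : ℝ → ℂ} {f' : ℂ}, HasDerivAt f f' t → HasDerivAt (fun s => (f s).re) f'.re t :=
    fun h => Complex.reCLM.hasFDerivAt.comp_hasDerivAt t h
  have im : ∀ {f : ℝ → ℂ} {f' : ℂ}, HasDerivAt f f' t → HasDerivAt (fun s => (f s).im) f'.im t :=
    fun h => Complex.imCLM.hasFDerivAt.comp_hasDerivAt t h
  refine (((re hz).mul (re hw)).add ((im hz).mul (im hw))).congr_deriv ?_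
  simp only [dot]; ring

lemma dot_comm (z w : ℂ) : dot z w = dot w z := by simp only [dot]; ring

lemma one_div_side_rpow (q : Fin 3 → ℂ) (l : Fin 3) (b : ℝ) :
    1 / side q l ^ b = dot (edge q l) (edge q l) ^ (-b / 2) := by
  rw [← side_sq, ← Real.rpow_natCast, ← Real.rpow_mul (side_nonneg q l), one_div,
    ← Real.rpow_neg (side_nonneg q l)]
  congr 1; push_cast; ring

lemma hasDerivAt_edge {q : ℝ → Fin 3 → ℂ} {v : Fin 3 → ℂ} {t : ℝ}
    (h : ∀ k, HasDerivAt (fun s => q s k) (v k) t) (l : Fin 3) :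
    HasDerivAt (fun s => edge (q s) l) (edge v l) t := (h _).sub (h _)

lemma hasDerivAt_one_div_side_rpow {q : ℝ → Fin 3 → ℂ} {v : Fin 3 → ℂ} {t : ℝ} {l : Fin 3}
    (hs : 0 < side (q t) l) (h : ∀ k, HasDerivAt (fun s => q s k) (v k) t) (b : ℝ) :
    HasDerivAt (fun s => 1 / side (q s) l ^ b)
      (-b * (1 / side (q t) l ^ (b + 2)) * dot (edge (q t) l) (edge v l)) t := by
  simp only [one_div_side_rpow]
  have hd := hasDerivAt_edge h l
  have hpos : 0 < dot (edge (q t) l) (edge (q t) l) := by rw [← side_sq]; positivity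
  refine ((hd.threeBody_dot hd).rpow_const (p := -b / 2) (Or.inl hpos.ne')).congr_deriv ?_
  rw [dot_comm (edge v l), show -(b + 2) / 2 = -b / 2 - 1 by ring]
  ring

lemma hasDerivAt_potential {a : ℝ} (ha : 0 < a) (m : Fin 3 → ℝ) {q : ℝ → Fin 3 → ℂ}
    {v : Fin 3 → ℂ} {t : ℝ} (hs : ∀ l, 0 < side (q t) l)
    (h : ∀ k, HasDerivAt (fun s => q s k) (v k) t) :
    HasDerivAt (fun s => potential a m (q s))
      (-∑ l, pairMass m l * (weight a (q t) l * dot (edge (q t) l) (edge v l))) t := by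
  have e : (fun s => potential a m (q s))
      = fun s => (1 / a) * ∑ l, pairMass m l * (1 / side (q s) l ^ a) := by
    funext s; simp only [potential, pairMass, mul_one_div]
  rw [e]
  refine ((HasDerivAt.fun_sum fun l _ => (hasDerivAt_one_div_side_rpow (hs l) h a).const_mul
    (pairMass m l)).const_mul (1 / a)).congr_deriv ?_
  rw [Finset.mul_sum, ← Finset.sum_neg_distrib]
  refine Finset.sum_congr rfl fun l _ => ?_
  rw [weight]
  field_simp

lemma hasDerivAt_inertia (m : Fin 3 → ℝ) {q : ℝ → Fin 3 → ℂ}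
    {v : Fin 3 → ℂ} {t : ℝ} (h : ∀ k, HasDerivAt (fun s => q s k) (v k) t) :
    HasDerivAt (fun s => inertia m (q s)) (2 * ∑ k, m k * dot (q t k) (v k)) t := by
  simp only [inertia_eq_sum_dot]
  refine (HasDerivAt.fun_sum fun k _ => ((h k).threeBody_dot (h k)).const_mul (m k)).congr_deriv ?_
  rw [Finset.mul_sum]
  refine Finset.sum_congr rfl fun l _ => ?_
  rw [dot_comm (v l)]; ring

/-- The factor of the derivative of the configurational measure along the velocity `v`. -/
noncomputable def measureRate (a : ℝ) (m : Fin 3 → ℝ) (q v : Fin 3 → ℂ) : ℝ :=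
  (∑ l, pairMass m l * (weight a q l * side q l ^ 2))
      * (∑ l, pairMass m l * dot (edge q l) (edge v l))
    - (∑ l, pairMass m l * side q l ^ 2)
      * ∑ l, pairMass m l * (weight a q l * dot (edge q l) (edge v l))

/-- The derivative of `U I^{a/2}` is `I^{a/2-1} / M` times `measureRate`. Dropping this nonzero
factor leaves an expression without powers of `I`, which is easier to differentiate again. -/
lemma measureRate_eq_zero {a : ℝ} (ha : 0 < a) {m : Fin 3 → ℝ} (hm : ∀ k, 0 < m k)
    {q : ℝ → Fin 3 → ℂ} {v : Fin 3 → ℂ} {t : ℝ} (hs : ∀ l, 0 < side (q t) l)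
    (hc : ∑ k, (m k : ℂ) * q t k = 0)
    (h : ∀ k, HasDerivAt (fun s => q s k) (v k) t) {μ : ℝ}
    (hμ : ∀ᶠ s in 𝓝 t, confMeasure a m (q s) = μ) : measureRate a m (q t) v = 0 := by
  have hI := inertia_pos hm hc hs
  have h1 := (hasDerivAt_potential ha m hs h).mul
    ((hasDerivAt_inertia m h).rpow_const (p := a / 2) (Or.inl hI.ne'))
  have h2 : HasDerivAt (fun _ : ℝ => μ) _ t :=
    h1.congr_of_eventuallyEq (hμ.mono fun s hs => hs.symm)
  have h3 := h2.unique (hasDerivAt_const t μ)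
  rw [Real.rpow_sub_one hI.ne'] at h3
  have h4 : inertia m (q t) ^ (a / 2) ≠ 0 := (Real.rpow_pos_of_pos hI _).ne'
  have hM := totalMass_pos hm
  have h5 : (-∑ l, pairMass m l * (weight a (q t) l * dot (edge (q t) l) (edge v l)))
      * inertia m (q t) + a * potential a m (q t) * ∑ k, m k * dot (q t k) (v k) = 0 := by
    have : inertia m (q t) ^ (a / 2) * ((-∑ l, pairMass m l * (weight a (q t) l *
        dot (edge (q t) l) (edge v l))) * inertia m (q t)
        + a * potential a m (q t) * ∑ k, m k * dot (q t k) (v k)) = 0 := by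
      generalize ∑ l, pairMass m l * (weight a (q t) l * dot (edge (q t) l) (edge v l)) = S at h3 ⊢
      field_simp at h3
      linear_combination h3
    exact (mul_eq_zero.1 this).resolve_left h4
  rw [measureRate, ← mul_potential ha m hs, ← totalMass_mul_inertia hc,
    ← totalMass_mul_sum_dot hc]
  linear_combination totalMass m * h5

lemma hasDerivAt_measureRate {a : ℝ} {m : Fin 3 → ℝ}
    {q v : ℝ → Fin 3 → ℂ} {w : Fin 3 → ℂ} {t : ℝ} (hs : ∀ l, 0 < side (q t) l)
    (h : ∀ k, HasDerivAt (fun s => q s k) (v t k) t)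
    (h' : ∀ k, HasDerivAt (fun s => v s k) (w k) t) :
    HasDerivAt (fun s => measureRate a m (q s) (v s))
      ((-a * ∑ l, pairMass m l * (weight a (q t) l * dot (edge (q t) l) (edge (v t) l)))
          * (∑ l, pairMass m l * dot (edge (q t) l) (edge (v t) l))
        + (∑ l, pairMass m l * (weight a (q t) l * side (q t) l ^ 2))
          * (∑ l, pairMass m l * (‖edge (v t) l‖ ^ 2 + dot (edge (q t) l) (edge w l)))
        - (2 * ∑ l, pairMass m l * dot (edge (q t) l) (edge (v t) l))
          * (∑ l, pairMass m l * (weight a (q t) l * dot (edge (q t) l) (edge (v t) l)))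
        - (∑ l, pairMass m l * side (q t) l ^ 2)
          * ∑ l, pairMass m l * (weight a (q t) l *
              (‖edge (v t) l‖ ^ 2 + dot (edge (q t) l) (edge w l))
            - (a + 2) * (weight a (q t) l / side (q t) l ^ 2
              * dot (edge (q t) l) (edge (v t) l) ^ 2))) t := by
  have hx : ∀ l, HasDerivAt (fun s => dot (edge (q s) l) (edge (v s) l))
      (‖edge (v t) l‖ ^ 2 + dot (edge (q t) l) (edge w l)) t := fun l =>
    ((hasDerivAt_edge h l).threeBody_dot (hasDerivAt_edge h' l)).congr_deriv (by rw [dot_self])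
  have hss : ∀ l, HasDerivAt (fun s => side (q s) l ^ 2)
      (2 * dot (edge (q t) l) (edge (v t) l)) t := fun l => by
    simp only [side_sq]
    exact ((hasDerivAt_edge h l).threeBody_dot (hasDerivAt_edge h l)).congr_deriv
      (by rw [dot_comm (edge (v t) l)]; ring)
  have hu : ∀ l, HasDerivAt (fun s => weight a (q s) l)
      (-(a + 2) * (weight a (q t) l / side (q t) l ^ 2)
        * dot (edge (q t) l) (edge (v t) l)) t := fun l => by
    refine (hasDerivAt_one_div_side_rpow (hs l) h (a + 2)).congr_deriv ?_
    rw [Real.rpow_add (hs l) (a + 2), Real.rpow_two, weight]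
    field_simp
  refine (((HasDerivAt.fun_sum fun l _ => ((hu l).mul (hss l)).const_mul (pairMass m l)).mul
    (HasDerivAt.fun_sum fun l _ => (hx l).const_mul (pairMass m l))).sub
    ((HasDerivAt.fun_sum fun l _ => (hss l).const_mul (pairMass m l)).mul
    (HasDerivAt.fun_sum fun l _ => ((hu l).mul (hx l)).const_mul (pairMass m l)))).congr_deriv ?_
  have h0 := (hs 0).ne'
  have h1 := (hs 1).ne'
  have h2 := (hs 2).ne'
  simp only [Fin.sum_univ_three, Pi.mul_apply]
  field_simp
  ring

/-! ### Second variation along a motion of constant measure -/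

/-- Second variation of the configurational measure in the direction `w`, for the rotation
rate `ω`, up to a positive factor. -/
noncomputable def secondVariation (a : ℝ) (m : Fin 3 → ℝ) (ω : ℝ) (q w : Fin 3 → ℂ) : ℝ :=
  (∑ l, pairMass m l * (weight a q l * side q l ^ 2)) * (∑ l, pairMass m l * ‖edge w l‖ ^ 2)
    - (∑ l, pairMass m l * side q l ^ 2) *
      ∑ l, pairMass m l * (weight a q l * (‖edge w l‖ ^ 2
        + 2 * ω * wedge (edge q l) (edge w l)
        - (a + 2) * (dot (edge q l) (edge w l) ^ 2 / side q l ^ 2)))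

/-- The velocity `w` is orthogonal to the infinitesimal similarities of `q`. -/
structure IsShapeVelocity (m : Fin 3 → ℝ) (q w : Fin 3 → ℂ) : Prop where
  centre : ∑ k, (m k : ℂ) * w k = 0
  dot : ∑ k, m k * dot (q k) (w k) = 0
  wedge : ∑ k, m k * wedge (q k) (w k) = 0

/-- The last hypothesis is the vanishing of the second derivative. The terms in `r²` cancel because
the measure is scale invariant, the pure `ω²` terms because it is rotation invariant. What remains
is the second variation plus `A1 * Γ - M * A0²`, which is nonnegative by Cauchy–Schwarz. -/
lemma secondVariation_nonpos {a : ℝ} {m : Fin 3 → ℝ} (hm : ∀ k, 0 < m k)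
    {q v w : Fin 3 → ℂ} {r ω : ℝ} (hs : ∀ l, 0 < side q l) (hc : ∑ k, (m k : ℂ) * q k = 0)
    (hw : IsShapeVelocity m q w) (hv : ∀ k, v k = (⟨r, ω⟩ : ℂ) * q k + w k)
    (hr : measureRate a m q v = 0)
    (h : (-a * ∑ l, pairMass m l * (weight a q l * dot (edge q l) (edge v l)))
          * (∑ l, pairMass m l * dot (edge q l) (edge v l))
        + (∑ l, pairMass m l * (weight a q l * side q l ^ 2))
          * (∑ l, pairMass m l * (‖edge v l‖ ^ 2 + dot (edge q l) (edge (accel a m q) l)))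
        - (2 * ∑ l, pairMass m l * dot (edge q l) (edge v l))
          * (∑ l, pairMass m l * (weight a q l * dot (edge q l) (edge v l)))
        - (∑ l, pairMass m l * side q l ^ 2)
          * ∑ l, pairMass m l * (weight a q l *
              (‖edge v l‖ ^ 2 + dot (edge q l) (edge (accel a m q) l))
            - (a + 2) * (weight a q l / side q l ^ 2
              * dot (edge q l) (edge v l) ^ 2)) = 0) :
    secondVariation a m ω q w ≤ 0 := by
  have hI := inertia_pos hm hc hs
  have hCS := sq_sum_weight_le (a := a) hm hI
  have hMI := totalMass_mul_inertia hc
  have hM := totalMass_pos hm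
  have hacc := sum_pairMass_dot_accel a m q
  have hk := totalMass_mul_sum_dot hc w
  have hg := totalMass_mul_sum_wedge hc w
  rw [hw.dot, mul_zero] at hk
  rw [hw.wedge, mul_zero] at hg
  have hx : ∀ l, dot (edge q l) (edge v l) = r * side q l ^ 2 + dot (edge q l) (edge w l) := by
    intro l
    rw [side_sq]
    simp only [edge, hv, dot, Complex.add_re, Complex.add_im, Complex.sub_re, Complex.sub_im,
      Complex.mul_re, Complex.mul_im]
    ring
  have hn : ∀ l, ‖edge v l‖ ^ 2 = (r ^ 2 + ω ^ 2) * side q l ^ 2 + ‖edge w l‖ ^ 2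
      + 2 * r * dot (edge q l) (edge w l) + 2 * ω * wedge (edge q l) (edge w l) := by
    intro l
    rw [side_sq, ← dot_self, ← dot_self]
    simp only [edge, hv, dot, wedge, Complex.add_re, Complex.add_im, Complex.sub_re,
      Complex.sub_im, Complex.mul_re, Complex.mul_im]
    ring
  set A0 := ∑ l, pairMass m l * (weight a q l * side q l ^ 2) with hA0
  set A1 := ∑ l, pairMass m l * side q l ^ 2 with hA1
  set Γ := -∑ l, pairMass m l * (weight a q l * dot (edge q l) (edge (accel a m q) l)) with hΓ
  have hA1pos : 0 < A1 := by rw [← hMI]; positivity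
  have hX1 : ∑ l, pairMass m l * dot (edge q l) (edge v l) = r * A1 := by
    simp only [hx, hA1, Fin.sum_univ_three] at hk ⊢
    linear_combination -hk
  have hX2 : ∑ l, pairMass m l * (weight a q l * dot (edge q l) (edge v l)) = r * A0 := by
    rw [measureRate, hX1] at hr
    have : A1 * (∑ l, pairMass m l * (weight a q l * dot (edge q l) (edge v l)) - r * A0) = 0 := by
      linear_combination -hr
    linarith [(mul_eq_zero.1 this).resolve_left hA1pos.ne']
  -- The potential is stationary along `w`: the radial part of `v` already accounts for the whole of
  -- `hX2`.
  have hK : ∑ l, pairMass m l * (weight a q l * dot (edge q l) (edge w l)) = 0 := by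
    simp only [hx, hA0, Fin.sum_univ_three] at hX2 ⊢
    linear_combination hX2
  have hY : ∑ l, pairMass m l * (‖edge v l‖ ^ 2 + dot (edge q l) (edge (accel a m q) l))
      = (r ^ 2 + ω ^ 2) * A1 + ∑ l, pairMass m l * ‖edge w l‖ ^ 2 - totalMass m * A0 := by
    simp only [hn, hA1, Fin.sum_univ_three] at hk hg hacc ⊢
    linear_combination hacc - 2 * r * hk - 2 * ω * hg
  have hV : ∀ l, weight a q l / side q l ^ 2 * dot (edge q l) (edge v l) ^ 2
      = r ^ 2 * (weight a q l * side q l ^ 2)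
        + 2 * r * (weight a q l * dot (edge q l) (edge w l))
        + weight a q l * (dot (edge q l) (edge w l) ^ 2 / side q l ^ 2) := by
    intro l
    have := (hs l).ne'
    rw [hx]
    field_simp
    ring
  have hZ : ∑ l, pairMass m l * (weight a q l *
              (‖edge v l‖ ^ 2 + dot (edge q l) (edge (accel a m q) l))
            - (a + 2) * (weight a q l / side q l ^ 2
              * dot (edge q l) (edge v l) ^ 2))
      = (r ^ 2 + ω ^ 2) * A0 - Γ - (a + 2) * r ^ 2 * A0
        + ∑ l, pairMass m l * (weight a q l * (‖edge w l‖ ^ 2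
        + 2 * ω * wedge (edge q l) (edge w l)
        - (a + 2) * (dot (edge q l) (edge w l) ^ 2 / side q l ^ 2))) := by
    simp only [hn, hV, hA0, hΓ, Fin.sum_univ_three] at hK ⊢
    linear_combination (2 * r - 2 * r * (a + 2)) * hK
  rw [hX1, hX2, hY, hZ] at h
  rw [secondVariation, ← hA0, ← hA1]
  have h6 : totalMass m * A0 ^ 2 ≤ A1 * Γ := by
    rw [← hMI]; nlinarith
  linarith

lemma IsSolution.side_pos {a : ℝ} {m : Fin 3 → ℝ} {J : Set ℝ} {q p : ℝ → Fin 3 → ℂ}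
    (h : IsSolution a m J q p) {t : ℝ} (ht : t ∈ J) (l : Fin 3) : 0 < side (q t) l := by
  rw [side, norm_pos_iff, sub_ne_zero]
  exact h.noCollision t ht _ _ (by fin_cases l <;> decide)

/-- `w` is the velocity minus its projection on the scaling and rotation directions `q` and `iq`. By
Pythagoras its squared norm is that of `v` minus `(r² + ω²) I`; multiplied by `I` this is `B - C²`.
-/
lemma exists_isShapeVelocity {a : ℝ} (ha : 0 < a) {m : Fin 3 → ℝ} (hm : ∀ k, 0 < m k)
    {J : Set ℝ} {q p : ℝ → Fin 3 → ℂ} (hJ : IsOpen J) (h : IsSolution a m J q p) {μ : ℝ}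
    (hμ : ∀ t ∈ J, confMeasure a m (q t) = μ) {t : ℝ} (ht : t ∈ J) :
    ∃ w, IsShapeVelocity m (q t) w ∧
      inertia m (q t) * inertia m w = constB a m q p t - angularMomentum (q t) (p t) ^ 2 ∧
      secondVariation a m (angularMomentum (q t) (p t) / inertia m (q t)) (q t) w ≤ 0 := by
  have hm' : ∀ k, (m k : ℂ) ≠ 0 := fun k => Complex.ofReal_ne_zero.2 (hm k).ne'
  have hs := h.side_pos ht
  have hc := h.centre t ht
  have hI := inertia_pos hm hc hs
  set v : ℝ → Fin 3 → ℂ := fun s k => p s k / (m k : ℂ) with hv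
  have hq : ∀ s ∈ J, ∀ k, HasDerivAt (fun s => q s k) (v s k) s := h.hasDerivAt_q
  have hp : ∀ k, HasDerivAt (fun s => v s k) (accel a m (q t) k) t := fun k => by
    refine ((h.hasDerivAt_p t ht k).div_const (m k : ℂ)).congr_deriv ?_
    rw [force_eq, mul_div_cancel_left₀ _ (hm' k), accel]
  have hrate : ∀ s ∈ J, measureRate a m (q s) (v s) = 0 := fun s hs' =>
    measureRate_eq_zero ha hm (h.side_pos hs') (h.centre s hs') (hq s hs')
      ((hJ.mem_nhds hs') |> fun hn => Filter.mem_of_superset hn hμ)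
  have hrate' := (hasDerivAt_measureRate (a := a) (m := m) hs (hq t ht) hp).unique
    ((hasDerivAt_const t (0 : ℝ)).congr_of_eventuallyEq
      (Filter.mem_of_superset (hJ.mem_nhds ht) hrate))
  have hcv : ∑ k, (m k : ℂ) * v t k = 0 := by
    have h1 : HasDerivAt (fun s => ∑ k, (m k : ℂ) * q s k) (∑ k, (m k : ℂ) * v t k) t :=
      HasDerivAt.fun_sum fun k _ => (hq t ht k).const_mul _
    exact h1.unique ((hasDerivAt_const t (0 : ℂ)).congr_of_eventuallyEq
      (Filter.mem_of_superset (hJ.mem_nhds ht) h.centre))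
  set i := inertia m (q t) with hi
  set r := (∑ k, m k * dot (q t k) (v t k)) / i with hr
  set c := angularMomentum (q t) (p t) with hcdef
  have hp' : ∀ k, p t k = (m k : ℂ) * v t k := fun k => by
    rw [hv]; exact (mul_div_cancel₀ _ (hm' k)).symm
  have hcm : c = ∑ k, m k * wedge (q t k) (v t k) := by
    simp only [hcdef, angularMomentum, hp', wedge, Complex.re_ofReal_mul, Complex.im_ofReal_mul]
    exact Finset.sum_congr rfl fun k _ => by ring
  have hrm : r * i = ∑ k, m k * dot (q t k) (v t k) := div_mul_cancel₀ _ hI.ne'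
  set ω := c / i with hω
  have hωm : ω * i = ∑ k, m k * wedge (q t k) (v t k) := by
    rw [← hcm]; exact div_mul_cancel₀ _ hI.ne'
  have hii := inertia_eq_sum_dot m (q t)
  rw [← hi] at hii
  have hTv : ∑ k, ‖p t k‖ ^ 2 / m k = ∑ k, m k * dot (v t k) (v t k) := by
    refine Finset.sum_congr rfl fun k _ => ?_
    rw [hp', norm_mul, dot_self, Complex.norm_real, Real.norm_of_nonneg (hm k).le]
    have := (hm k).ne'
    field_simp
  have hB : constB a m q p t = i * (∑ k, m k * dot (v t k) (v t k)) - r ^ 2 * i ^ 2 := by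
    -- This makes the potential energy drop out of `constB`, leaving only kinetic terms.
    have h1 : i ^ (a / 2) * i ^ ((2 - a) / 2) = i := by
      rw [← Real.rpow_add hI]
      convert Real.rpow_one i using 2
      ring
    rw [constB, (hasDerivAt_inertia m (hq t ht)).deriv, energy, kinetic, confMeasure, hTv, ← hi,
      ← hrm]
    linear_combination 2 * potential a m (q t) * h1
  have hw : IsShapeVelocity m (q t) fun k => v t k - (⟨r, ω⟩ : ℂ) * q t k := by
    constructor
    · simp only [mul_sub, Finset.sum_sub_distrib, hcv]
      rw [zero_sub, neg_eq_zero]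
      calc ∑ k, (m k : ℂ) * ((⟨r, ω⟩ : ℂ) * q t k)
          = (⟨r, ω⟩ : ℂ) * ∑ k, (m k : ℂ) * q t k := by
            rw [Finset.mul_sum]; exact Finset.sum_congr rfl fun k _ => by ring
        _ = 0 := by rw [hc, mul_zero]
    · simp only [dot, Fin.sum_univ_three, Complex.sub_re, Complex.sub_im, Complex.mul_re,
        Complex.mul_im] at hrm hii ⊢
      linear_combination r * hii - hrm
    · simp only [wedge, dot, Fin.sum_univ_three, Complex.sub_re, Complex.sub_im, Complex.mul_re,
        Complex.mul_im] at hωm hii ⊢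
      linear_combination ω * hii - hωm
  refine ⟨_, hw, ?_, secondVariation_nonpos (v := v t) (r := r) hm hs hc hw (fun k => by ring)
      (hrate t ht) hrate'⟩
  · have hci : c = ω * i := (div_mul_cancel₀ _ hI.ne').symm
    rw [hB, hci, inertia_eq_sum_dot m fun k => v t k - (⟨r, ω⟩ : ℂ) * q t k]
    have : ∑ k, m k * dot (v t k - (⟨r, ω⟩ : ℂ) * q t k) (v t k - (⟨r, ω⟩ : ℂ) * q t k)
        = ∑ k, m k * dot (v t k) (v t k) - (r ^ 2 + ω ^ 2) * i := by
      simp only [wedge, dot, Fin.sum_univ_three, Complex.sub_re, Complex.sub_im, Complex.mul_re,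
        Complex.mul_im] at hωm hrm hii ⊢
      linear_combination 2 * r * hrm + 2 * ω * hωm - (r ^ 2 + ω ^ 2) * hii
    rw [this]; ring

/-! ### Positivity at the equilateral triangle -/

/-- With equal sides and weights, the terms `‖edge w l‖²` cancel and the term in `ω` vanishes
because `w` is orthogonal to rotations. A weighted sum of the squares of `dot (edge q l) (edge w l)`
remains. If it were zero, `w` would preserve all side lengths to first order, hence be an
infinitesimal rotation, hence zero. -/
lemma secondVariation_pos {a : ℝ} (ha : 0 < a) {m : Fin 3 → ℝ} (hm : ∀ k, 0 < m k)
    {q w : Fin 3 → ℂ} (ω : ℝ) (hq : IsEquilateral q) (hc : ∑ k, (m k : ℂ) * q k = 0)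
    (hw : IsShapeVelocity m q w) (hw0 : 0 < inertia m w) : 0 < secondVariation a m ω q w := by
  obtain ⟨h0, h01, h12⟩ := hq
  have hk := totalMass_mul_sum_dot hc w
  have hg := totalMass_mul_sum_wedge hc w
  have hY := totalMass_mul_inertia hw.centre
  rw [hw.dot, mul_zero] at hk
  rw [hw.wedge, mul_zero] at hg
  have hM := totalMass_pos hm
  have hm0 := pairMass_pos hm 0
  have hm1 := pairMass_pos hm 1
  have hm2 := pairMass_pos hm 2
  set s := side q 0 with hs
  have hs1 : side q 1 = s := h01.symm
  have hs2 : side q 2 = s := h12.symm.trans h01.symm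
  set u := weight a q 0 with hu
  have hu0 : 0 < u := weight_pos h0
  have hu1 : weight a q 1 = u := by rw [hu, weight, weight, hs1]
  have hu2 : weight a q 2 = u := by rw [hu, weight, weight, hs2]
  have key : secondVariation a m ω q w = (a + 2) * u * (pairMass m 0 + pairMass m 1 + pairMass m 2)
      * ∑ l, pairMass m l * dot (edge q l) (edge w l) ^ 2 := by
    simp only [secondVariation, Fin.sum_univ_three, hs1, hs2, ← hs, hu1, hu2, ← hu] at hg ⊢
    field_simp
    linear_combination 2 * s ^ 2 * ω * hg
  rw [key]
  have hn : 0 ≤ ∑ l, pairMass m l * dot (edge q l) (edge w l) ^ 2 :=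
    Finset.sum_nonneg fun l _ => mul_nonneg (pairMass_pos hm l).le (sq_nonneg _)
  refine mul_pos (by positivity) (lt_of_le_of_ne hn fun hne => hw0.ne' ?_)
  have hz := (Finset.sum_eq_zero_iff_of_nonneg fun l _ =>
    mul_nonneg (pairMass_pos hm l).le (sq_nonneg _)).1 hne.symm
  have hz' : ∀ l, dot (edge q l) (edge w l) = 0 := fun l =>
    pow_eq_zero_iff two_ne_zero |>.1
      ((mul_eq_zero.1 (hz l (Finset.mem_univ l))).resolve_left (pairMass_pos hm l).ne')
  -- each side of `w` is a multiple of the side of `q` turned by a right angle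
  set d := edge q with hd
  set y := edge w with hy
  have hd2 : d 2 = -(d 0 + d 1) := by simp only [hd, edge, Fin.reduceAdd]; ring
  have hy2 : y 2 = -(y 0 + y 1) := by simp only [hy, edge, Fin.reduceAdd]; ring
  have hS0 : s ^ 2 = dot (d 0) (d 0) := side_sq q 0
  have hS1 : s ^ 2 = dot (d 1) (d 1) := by rw [← hs1]; exact side_sq q 1
  have hS2 : s ^ 2 = dot (d 2) (d 2) := by rw [← hs2]; exact side_sq q 2
  have hrot : ∀ l, dot (d l) (d l) = s ^ 2 → s ^ 2 * (y l).re = -wedge (d l) (y l) * (d l).im ∧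
      s ^ 2 * (y l).im = wedge (d l) (y l) * (d l).re := fun l hl => by
    have := hz' l
    simp only [dot, wedge] at hl this ⊢
    constructor
    · linear_combination -(y l).re * hl + (d l).re * this
    · linear_combination -(y l).im * hl + (d l).im * this
  have hD : dot (d 0) (d 1) = -s ^ 2 / 2 := by
    rw [hd2] at hS2
    simp only [dot, Complex.neg_re, Complex.neg_im, Complex.add_re, Complex.add_im] at hS0 hS1 hS2 ⊢
    linear_combination -hS2 / 2 + hS0 / 2 + hS1 / 2
  -- Otherwise Lagrange's identity would give `s⁴ / 4 = s⁴`.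
  have hW : wedge (d 0) (d 1) ≠ 0 := by
    intro hW
    have : dot (d 0) (d 1) ^ 2 + wedge (d 0) (d 1) ^ 2 = dot (d 0) (d 0) * dot (d 1) (d 1) := by
      simp only [dot, wedge]; ring
    rw [hW, hD, ← hS0, ← hS1] at this
    have h4 : 0 < s ^ 4 := by positivity
    nlinarith
  -- Orthogonality on the third side, expanded through the closing relations; it forces the turning
  -- rates of sides 0 and 1 to agree.
  have hx : dot (d 0) (y 1) + dot (d 1) (y 0) = 0 := by
    have h2 := hz' 2
    have h0' := hz' 0
    have h1' := hz' 1
    rw [hd2, hy2] at h2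
    simp only [dot, Complex.neg_re, Complex.neg_im, Complex.add_re, Complex.add_im] at *
    linear_combination h2 - h0' - h1'
  obtain ⟨a0, b0⟩ := hrot 0 hS0.symm
  obtain ⟨a1, b1⟩ := hrot 1 hS1.symm
  have hs2pos : 0 < s ^ 2 := by positivity
  have hcc : wedge (d 0) (y 0) = wedge (d 1) (y 1) := by
    have : wedge (d 0) (d 1) * (wedge (d 0) (y 0) - wedge (d 1) (y 1)) = 0 := by
      have e : s ^ 2 * (dot (d 0) (y 1) + dot (d 1) (y 0)) = 0 := by rw [hx, mul_zero]
      have e' : wedge (d 0) (d 1) * (wedge (d 0) (y 0) - wedge (d 1) (y 1))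
          = wedge (d 1) (y 1) * (-(d 0).re * (d 1).im + (d 0).im * (d 1).re)
            + wedge (d 0) (y 0) * (-(d 1).re * (d 0).im + (d 1).im * (d 0).re) := by
        rw [wedge]; ring
      rw [e', ← e]
      simp only [dot]
      linear_combination -(d 0).re * a1 - (d 0).im * b1 - (d 1).re * a0 - (d 1).im * b0
    linarith [(mul_eq_zero.1 this).resolve_left hW]
  have hc2 : wedge (d 2) (y 2) = wedge (d 0) (y 0) := by
    have : s ^ 2 * (wedge (d 2) (y 2) - wedge (d 0) (y 0)) = 0 := by
      rw [hd2, hy2]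
      rw [← hcc] at a1 b1
      have e : s ^ 2 * wedge (-(d 0 + d 1)) (-(y 0 + y 1))
          = ((d 0).re + (d 1).re) * (s ^ 2 * (y 0).im + s ^ 2 * (y 1).im)
            - ((d 0).im + (d 1).im) * (s ^ 2 * (y 0).re + s ^ 2 * (y 1).re) := by
        simp only [wedge, Complex.neg_re, Complex.neg_im, Complex.add_re, Complex.add_im]; ring
      rw [mul_sub, e, a0, b0, a1, b1]
      generalize wedge (d 0) (y 0) = c
      simp only [dot] at hS0 hS1 hD
      linear_combination -c * hS0 - c * hS1 + 2 * c * hD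
    linarith [(mul_eq_zero.1 this).resolve_left hs2pos.ne']
  -- The common turning rate is zero because `w` has no angular momentum about `q`.
  have hc0 : wedge (d 0) (y 0) = 0 := by
    rw [Fin.sum_univ_three, hc2, ← hcc] at hg
    have : (pairMass m 0 + pairMass m 1 + pairMass m 2) * wedge (d 0) (y 0) = 0 := by
      linear_combination -hg
    exact (mul_eq_zero.1 this).resolve_left (by positivity)
  have hy00 : y 0 = 0 := by
    rw [hc0] at a0 b0
    apply Complex.ext
    · simpa [h0.ne'] using a0
    · simpa [h0.ne'] using b0
  have hy01 : y 1 = 0 := by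
    rw [← hcc, hc0] at a1 b1
    apply Complex.ext
    · simpa [h0.ne'] using a1
    · simpa [h0.ne'] using b1
  have : totalMass m * inertia m w = 0 := by
    rw [hY, Fin.sum_univ_three]
    simp only [side_eq_norm_edge, ← hy, hy2, hy00, hy01]
    simp
  exact (mul_eq_zero.1 this).resolve_left hM.ne'

/-! ### Continuity and compactness -/

lemma continuous_edge (l : Fin 3) : Continuous fun q : Fin 3 → ℂ => edge q l := by
  unfold edge; fun_prop

lemma continuous_side (l : Fin 3) : Continuous fun q : Fin 3 → ℂ => side q l := by
  unfold side; fun_prop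

lemma continuous_inertia (m : Fin 3 → ℝ) : Continuous fun q : Fin 3 → ℂ => inertia m q := by
  unfold inertia; fun_prop

lemma continuous_dot : Continuous fun z : ℂ × ℂ => dot z.1 z.2 := by
  unfold dot
  fun_prop

lemma continuous_wedge : Continuous fun z : ℂ × ℂ => wedge z.1 z.2 := by
  unfold wedge
  fun_prop

lemma continuousAt_weight (a : ℝ) {q : Fin 3 → ℂ} {l : Fin 3} (h : 0 < side q l) :
    ContinuousAt (fun q => weight a q l) q :=
  continuousAt_const.div ((continuous_side l).continuousAt.rpow_const (Or.inl h.ne'))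
    (Real.rpow_pos_of_pos h _).ne'

lemma continuousAt_secondVariation (a : ℝ) (m : Fin 3 → ℝ) (ω : ℝ) {q w : Fin 3 → ℂ}
    (h : ∀ l, 0 < side q l) :
    ContinuousAt (fun z : (Fin 3 → ℂ) × (Fin 3 → ℂ) => secondVariation a m ω z.1 z.2) (q, w) := by
  have hs : ∀ l, ContinuousAt (fun z : (Fin 3 → ℂ) × (Fin 3 → ℂ) => side z.1 l) (q, w) :=
    fun l => ((continuous_side l).comp continuous_fst).continuousAt
  have hu : ∀ l, ContinuousAt (fun z : (Fin 3 → ℂ) × (Fin 3 → ℂ) => weight a z.1 l) (q, w) :=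
    fun l => ContinuousAt.comp (x := (q, w)) (g := fun q => weight a q l) (f := Prod.fst)
      (continuousAt_weight a (h l)) continuousAt_fst
  have hy : ∀ l, ContinuousAt (fun z : (Fin 3 → ℂ) × (Fin 3 → ℂ) => ‖edge z.2 l‖) (q, w) :=
    fun l => ((continuous_edge l).comp continuous_snd).norm.continuousAt
  have hp : ∀ l, Continuous fun z : (Fin 3 → ℂ) × (Fin 3 → ℂ) => (edge z.1 l, edge z.2 l) :=
    fun l => ((continuous_edge l).comp continuous_fst).prodMk
      ((continuous_edge l).comp continuous_snd)
  have hd : ∀ l, ContinuousAt (fun z : (Fin 3 → ℂ) × (Fin 3 → ℂ) => dot (edge z.1 l) (edge z.2 l))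
      (q, w) := fun l => (continuous_dot.comp (hp l)).continuousAt
  have hg : ∀ l, ContinuousAt
      (fun z : (Fin 3 → ℂ) × (Fin 3 → ℂ) => wedge (edge z.1 l) (edge z.2 l)) (q, w) :=
    fun l => (continuous_wedge.comp (hp l)).continuousAt
  have h1 : ∀ f : Fin 3 → ((Fin 3 → ℂ) × (Fin 3 → ℂ)) → ℝ, (∀ l, ContinuousAt (f l) (q, w)) →
      ContinuousAt (fun z => ∑ l, pairMass m l * f l z) (q, w) := fun f hf =>
    tendsto_finsetSum _ fun l _ => continuousAt_const.mul (hf l)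
  refine ((h1 _ fun l => (hu l).mul ((hs l).pow 2)).mul (h1 _ fun l => (hy l).pow 2)).sub
    ((h1 _ fun l => (hs l).pow 2).mul (h1 _ fun l => (hu l).mul ((((hy l).pow 2).add
      (continuousAt_const.mul (hg l))).sub (continuousAt_const.mul
        (((hd l).pow 2).div ((hs l).pow 2) ?_)))))
  exact (pow_pos (h l) 2).ne'

lemma norm_le_of_inertia_eq {m : Fin 3 → ℝ} (hm : ∀ k, 0 < m k) (b : ℝ) :
    ∃ R, ∀ q : Fin 3 → ℂ, inertia m q = b → ‖q‖ ≤ R := by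
  -- The summand 1 allows `x ≤ 1 + x²` to be used in place of a square root.
  refine ⟨1 + ∑ k, |b| / m k, fun q hq => ?_⟩
  have h0 : 0 ≤ ∑ k, |b| / m k := Finset.sum_nonneg fun k _ => div_nonneg (abs_nonneg _) (hm k).le
  rw [pi_norm_le_iff_of_nonneg (by positivity)]
  intro k
  have h1 : m k * ‖q k‖ ^ 2 ≤ |b| := by
    refine le_trans ?_ (le_abs_self b)
    rw [← hq, inertia]
    exact Finset.single_le_sum (f := fun k => m k * ‖q k‖ ^ 2)
      (fun j _ => mul_nonneg (hm j).le (sq_nonneg _)) (Finset.mem_univ k)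
  have h2 : ‖q k‖ ^ 2 ≤ |b| / m k := by
    rw [le_div_iff₀ (hm k)]; linarith
  have h3 : |b| / m k ≤ ∑ k, |b| / m k := Finset.single_le_sum (f := fun k => |b| / m k)
    (fun j _ => div_nonneg (abs_nonneg _) (hm j).le) (Finset.mem_univ k)
  nlinarith [sq_nonneg (‖q k‖ - 1), norm_nonneg (q k)]

lemma isEquilateral_of_sides_eq {m : Fin 3 → ℝ} {q : Fin 3 → ℂ}
    (hc : ∑ k, (m k : ℂ) * q k = 0) (hI : 0 < inertia m q) (hM : 0 < totalMass m)
    (h01 : side q 0 = side q 1) (h12 : side q 1 = side q 2) : IsEquilateral q := by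
  refine ⟨lt_of_le_of_ne (side_nonneg q 0) fun h0 => ?_, h01, h12⟩
  have h := totalMass_mul_inertia hc
  rw [Fin.sum_univ_three, ← h12, ← h01, ← h0] at h
  have := mul_pos hM hI
  rw [h] at this
  simp at this

/-- If no `δ` worked, counterexamples with `δ = 1/(n+1)` would stay bounded, the inertias of `q` and
`w` being fixed. A limit point would be an equilateral triangle with a nonzero shape velocity and
nonpositive second variation. -/
lemma exists_no_constant_measure {a : ℝ} (ha : 0 < a) {m : Fin 3 → ℝ} (hm : ∀ k, 0 < m k)
    {I₀ C β : ℝ} (hI₀ : 0 < I₀) (hβ : 0 < β) :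
    ∃ δ : ℝ, 0 < δ ∧ ∀ q w e : Fin 3 → ℂ, (∑ k, (m k : ℂ) * q k = 0) → inertia m q = I₀ →
      IsShapeVelocity m q w → I₀ * inertia m w = β → IsEquilateral e → (∀ k, ‖q k - e k‖ < δ) →
      0 < secondVariation a m (C / I₀) q w := by
  by_contra! hcon
  choose q w e hc hI hw hw' he hδ hneg using
    fun n : ℕ => hcon (1 / ((n : ℝ) + 1)) Nat.one_div_pos_of_nat
  have hIw : ∀ n, inertia m (w n) = β / I₀ := fun n => by
    rw [eq_div_iff hI₀.ne', ← hw' n, mul_comm]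
  obtain ⟨R, hR⟩ := norm_le_of_inertia_eq hm I₀
  obtain ⟨R', hR'⟩ := norm_le_of_inertia_eq hm (β / I₀)
  obtain ⟨⟨q₀, w₀⟩, -, φ, hφ, hlim⟩ := tendsto_subseq_of_bounded
    ((Metric.isBounded_closedBall (x := (0 : Fin 3 → ℂ)) (r := R)).prod
      (Metric.isBounded_closedBall (x := (0 : Fin 3 → ℂ)) (r := R'))) (x := fun n => (q n, w n))
    (fun n => ⟨by simpa using hR _ (hI n), by simpa using hR' _ (hIw n)⟩)
  have hq : Tendsto (fun n => q (φ n)) atTop (𝓝 q₀) := (continuous_fst.tendsto _).comp hlim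
  have hwl : Tendsto (fun n => w (φ n)) atTop (𝓝 w₀) := (continuous_snd.tendsto _).comp hlim
  have hel : Tendsto (fun n => e (φ n)) atTop (𝓝 q₀) := by
    have h0 : Tendsto (fun n => e (φ n) - q (φ n)) atTop (𝓝 0) := by
      refine squeeze_zero_norm (fun n => ?_)
        (tendsto_one_div_add_atTop_nhds_zero_nat.comp hφ.tendsto_atTop)
      rw [norm_sub_rev, pi_norm_le_iff_of_nonneg (by simp only [Function.comp]; positivity)]
      exact fun k => (hδ (φ n) k).le
    simpa using h0.add hq
  have hlimeq : ∀ {f : (Fin 3 → ℂ) × (Fin 3 → ℂ) → ℝ} {b : ℝ}, Continuous f →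
      (∀ n, f (q n, w n) = b) → f (q₀, w₀) = b := fun {f b} hf hb =>
    tendsto_nhds_unique ((hf.tendsto _).comp hlim)
      (tendsto_const_nhds.congr fun n => (hb (φ n)).symm)
  have hcent : ∀ {x : ℕ → Fin 3 → ℂ} {x₀ : Fin 3 → ℂ}, Tendsto (fun n => x (φ n)) atTop (𝓝 x₀) →
      (∀ n, ∑ k, (m k : ℂ) * x n k = 0) → ∑ k, (m k : ℂ) * x₀ k = 0 := fun {x x₀} hx h0 => by
    have hf : Continuous fun x : Fin 3 → ℂ => ∑ k, (m k : ℂ) * x k := by fun_prop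
    exact tendsto_nhds_unique ((hf.tendsto _).comp hx)
      (tendsto_const_nhds.congr fun n => (h0 (φ n)).symm)
  have hc₀ := hcent hq hc
  have hI0 : inertia m q₀ = I₀ :=
    hlimeq (f := fun z => inertia m z.1) ((continuous_inertia m).comp continuous_fst) hI
  have hw0 : inertia m w₀ = β / I₀ :=
    hlimeq (f := fun z => inertia m z.2) ((continuous_inertia m).comp continuous_snd) hIw
  have hsv : IsShapeVelocity m q₀ w₀ := by
    refine ⟨hcent hwl fun n => (hw n).centre, ?_, ?_⟩
    · refine hlimeq (f := fun z => ∑ k, m k * dot (z.1 k) (z.2 k)) ?_ fun n => (hw n).dot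
      unfold dot; fun_prop
    · refine hlimeq (f := fun z => ∑ k, m k * wedge (z.1 k) (z.2 k)) ?_ fun n => (hw n).wedge
      unfold wedge; fun_prop
  have hse : ∀ l, Tendsto (fun n => side (e (φ n)) l) atTop (𝓝 (side q₀ l)) := fun l =>
    ((continuous_side l).tendsto _).comp hel
  -- The triangles `e n` may have any size; equality of sides passes to the limit, and nondegeneracy
  -- comes from `I₀ > 0`.
  have heq : IsEquilateral q₀ := isEquilateral_of_sides_eq hc₀ (hI0 ▸ hI₀) (totalMass_pos hm)
    (tendsto_nhds_unique (hse 0) ((hse 1).congr fun n => (he (φ n)).2.1.symm))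
    (tendsto_nhds_unique (hse 1) ((hse 2).congr fun n => (he (φ n)).2.2.symm))
  have hpos := secondVariation_pos ha hm (C / I₀) heq hc₀ hsv (hw0 ▸ div_pos hβ hI₀)
  have hsides : ∀ l, 0 < side q₀ l := by
    obtain ⟨h0, h1, h2⟩ := heq
    intro l
    fin_cases l
    · exact h0
    · exact h1 ▸ h0
    · exact h2 ▸ h1 ▸ h0
  have hlim' := (continuousAt_secondVariation a m (C / I₀) (w := w₀) hsides).tendsto.comp hlim
  exact hpos.not_ge (le_of_tendsto hlim' (Eventually.of_forall fun n => hneg (φ n)))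

/-! ### Normalized configurations and a formula for `ρ²` -/

lemma massPairs_pos {m : Fin 3 → ℝ} (hm : ∀ k, 0 < m k) : 0 < massPairs m :=
  Finset.sum_pos (fun l _ => pairMass_pos hm l) Finset.univ_nonempty

/-- Moment of inertia with respect to the centre of mass. -/
noncomputable def centralInertia (m : Fin 3 → ℝ) (q : Fin 3 → ℂ) : ℝ :=
  inertia m fun j => q j - (∑ k, (m k : ℂ) * q k) / (totalMass m : ℂ)

lemma centre_sub {m : Fin 3 → ℝ} (hM : totalMass m ≠ 0) (q : Fin 3 → ℂ) :
    ∑ j, (m j : ℂ) * (q j - (∑ k, (m k : ℂ) * q k) / (totalMass m : ℂ)) = 0 := by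
  have h : (∑ k, (m k : ℂ)) = (totalMass m : ℂ) := by simp [totalMass]
  have hM' : (totalMass m : ℂ) ≠ 0 := Complex.ofReal_ne_zero.2 hM
  simp only [mul_sub, Finset.sum_sub_distrib, ← Finset.sum_mul, h]
  rw [mul_div_cancel₀ _ hM', sub_self]

lemma totalMass_mul_centralInertia {m : Fin 3 → ℝ} (hM : totalMass m ≠ 0) (q : Fin 3 → ℂ) :
    totalMass m * centralInertia m q = ∑ l, pairMass m l * side q l ^ 2 := by
  rw [centralInertia, totalMass_mul_inertia (centre_sub hM q)]
  simp [side]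

lemma normalized_apply (m : Fin 3 → ℝ) (q : Fin 3 → ℂ) (k : Fin 3) :
    normalized m q k = (q k - (∑ j, (m j : ℂ) * q j) / (totalMass m : ℂ))
      / (Real.sqrt (centralInertia m q) : ℂ) := rfl

lemma centre_normalized {m : Fin 3 → ℝ} (hM : totalMass m ≠ 0) (q : Fin 3 → ℂ) :
    ∑ k, (m k : ℂ) * normalized m q k = 0 := by
  simp only [normalized_apply, ← mul_div_assoc]
  rw [← Finset.sum_div, centre_sub hM, zero_div]

lemma inertia_normalized {m : Fin 3 → ℝ} {q : Fin 3 → ℂ} (h : 0 < centralInertia m q) :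
    inertia m (normalized m q) = 1 := by
  simp only [inertia, normalized_apply, norm_div, div_pow, Complex.norm_real, Real.norm_eq_abs,
    sq_abs, Real.sq_sqrt h.le, ← mul_div_assoc]
  rw [← Finset.sum_div]
  exact div_self h.ne'

lemma side_normalized (m : Fin 3 → ℝ) (q : Fin 3 → ℂ) (l : Fin 3) :
    side (normalized m q) l = side q l / Real.sqrt (centralInertia m q) := by
  rw [side, normalized_apply, normalized_apply, ← sub_div, sub_sub_sub_cancel_right, norm_div,
    Complex.norm_real, Real.norm_of_nonneg (Real.sqrt_nonneg _), side]

lemma sum_sides_of_inertia_eq_one {m : Fin 3 → ℝ} {Q : Fin 3 → ℂ}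
    (hc : ∑ k, (m k : ℂ) * Q k = 0) (hI : inertia m Q = 1) :
    ∑ l, pairMass m l * side Q l ^ 2 = totalMass m := by
  rw [← totalMass_mul_inertia hc, hI, mul_one]

lemma mul_confMeasure {a : ℝ} (ha : 0 < a) {m : Fin 3 → ℝ} {Q : Fin 3 → ℂ}
    (hI : inertia m Q = 1) (hs : ∀ l, 0 < side Q l) :
    a * confMeasure a m Q = ∑ l, pairMass m l * (weight a Q l * side Q l ^ 2) := by
  rw [confMeasure, hI, Real.one_rpow, mul_one, mul_potential ha m hs]

/-- Deviation of the weight of the side opposite to `l` from the mean weight. -/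
noncomputable def deviation (a : ℝ) (m : Fin 3 → ℝ) (Q : Fin 3 → ℂ) (l : Fin 3) : ℝ :=
  (1 / totalMass m) * ∑ k, pairMass m k * (side Q k ^ 2 * (weight a Q k - weight a Q l))

/-- Centring writes `M Q_k` in terms of the two edges at the vertex, as the force already is. The
coefficients then combine to `aμ/M` minus a weight, and `∑ pairMass · side² = M` turns this into an
average of differences of weights. -/
lemma bigG_eq {a : ℝ} (ha : 0 < a) {m : Fin 3 → ℝ} (hM : 0 < totalMass m) {Q : Fin 3 → ℂ}
    (hc : ∑ k, (m k : ℂ) * Q k = 0) (hI : inertia m Q = 1) (hs : ∀ l, 0 < side Q l) (k : Fin 3) :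
    bigG a m Q k = (m k : ℂ) * ((m (k + 1) * deviation a m Q (k + 2) : ℝ) * edge Q (k + 2)
      - (m (k + 2) * deviation a m Q (k + 1) : ℝ) * edge Q (k + 1)) := by
  have hdev : ∀ l, deviation a m Q l = a * confMeasure a m Q / totalMass m - weight a Q l := by
    intro l
    have h1 := sum_sides_of_inertia_eq_one hc hI
    rw [mul_confMeasure ha hI hs, deviation, eq_sub_iff_add_eq, eq_div_iff hM.ne', add_mul,
      mul_comm (1 / _), mul_one_div, div_mul_cancel₀ _ hM.ne', ← h1, Finset.mul_sum,
      ← Finset.sum_add_distrib]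
    exact Finset.sum_congr rfl fun j _ => by ring
  have hQ : (totalMass m : ℂ) * Q k
      = (m (k + 1) : ℂ) * edge Q (k + 2) - (m (k + 2) : ℂ) * edge Q (k + 1) := by
    simp only [Fin.sum_univ_three, totalMass, edge] at hc ⊢
    push_cast
    fin_cases k
    · simp only [Fin.reduceFinMk, Fin.zero_eta, Fin.mk_one, Fin.reduceAdd, zero_add]
      linear_combination hc
    · simp only [Fin.reduceFinMk, Fin.zero_eta, Fin.mk_one, Fin.reduceAdd, zero_add]
      linear_combination hc
    · simp only [Fin.reduceFinMk, Fin.zero_eta, Fin.mk_one, Fin.reduceAdd, zero_add]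
      linear_combination hc
  have hM' : (totalMass m : ℂ) ≠ 0 := Complex.ofReal_ne_zero.2 hM.ne'
  have hQ' := eq_div_of_mul_eq hM' ((mul_comm _ _).trans hQ)
  rw [bigG, force_eq, hdev, hdev, hQ']
  push_cast
  field_simp
  ring

lemma rho_sq {a : ℝ} (ha : 0 < a) {m : Fin 3 → ℝ} (hm : ∀ k, 0 < m k) {Q : Fin 3 → ℂ}
    (hc : ∑ k, (m k : ℂ) * Q k = 0) (hI : inertia m Q = 1) (hs : ∀ l, 0 < side Q l) :
    rho a m Q ^ 2 = (∏ k, m k) / totalMass m * ∑ k, m k *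
      (m (k + 1) ^ 2 * side Q (k + 2) ^ 2 * (deviation a m Q (k + 2) * deviation a m Q (k + 2))
        + m (k + 2) ^ 2 * side Q (k + 1) ^ 2 * (deviation a m Q (k + 1) * deviation a m Q (k + 1))
        - m (k + 1) * m (k + 2) * (side Q k ^ 2 - side Q (k + 1) ^ 2 - side Q (k + 2) ^ 2)
          * (deviation a m Q (k + 1) * deviation a m Q (k + 2))) := by
  have hM := totalMass_pos hm
  have hP : 0 < ∏ k, m k := Finset.prod_pos fun k _ => hm k
  rw [rho, Real.sq_sqrt (mul_nonneg (div_pos hP hM).le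
    (Finset.sum_nonneg fun k _ => div_nonneg (sq_nonneg _) (hm k).le))]
  congr 1
  refine Finset.sum_congr rfl fun k _ => ?_
  rw [bigG_eq ha hM hc hI hs, norm_mul, mul_pow, Complex.norm_real,
    Real.norm_of_nonneg (hm k).le, ← dot_self]
  generalize deviation a m Q (k + 1) = x
  generalize deviation a m Q (k + 2) = y
  have h1 : (k + 1 + 1 : Fin 3) = k + 2 := by fin_cases k <;> rfl
  have h2 : (k + 1 + 2 : Fin 3) = k := by fin_cases k <;> rfl
  have h3 : (k + 2 + 1 : Fin 3) = k := by fin_cases k <;> rfl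
  have h4 : (k + 2 + 2 : Fin 3) = k + 1 := by fin_cases k <;> rfl
  have := (hm k).ne'
  simp only [side_sq, dot, edge, h1, h2, h3, h4, Complex.sub_re, Complex.sub_im,
    Complex.re_ofReal_mul, Complex.im_ofReal_mul]
  field_simp
  ring

lemma area2_sq (Q : Fin 3 → ℂ) : area2 Q ^ 2 = side Q 0 ^ 2 * side Q 1 ^ 2
    - (1 / 4) * (side Q 2 ^ 2 - side Q 0 ^ 2 - side Q 1 ^ 2) ^ 2 := by
  simp only [side_sq, area2, Fin.sum_univ_three, wedge, dot, edge, Fin.reduceAdd, zero_add,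
    Complex.sub_re, Complex.sub_im]
  ring

/-! ### Calculus of leading terms -/

/-- `f` has the leading term `g`, homogeneous of degree `n`, at the origin. -/
def HasLeadingTerm (n : ℕ) (f g : ℝ × ℝ → ℝ) : Prop :=
  (g =O[𝓝 0] fun z : ℝ × ℝ => ‖z‖ ^ n) ∧ (fun z => f z - g z) =o[𝓝 0] fun z : ℝ × ℝ => ‖z‖ ^ n

namespace HasLeadingTerm

lemma of_tendsto {f : ℝ × ℝ → ℝ} {c : ℝ} (h : Tendsto f (𝓝 0) (𝓝 c)) :
    HasLeadingTerm 0 f fun _ => c := by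
  constructor
  · simpa using isBigO_const_const c (one_ne_zero (α := ℝ)) _
  · simp only [pow_zero]
    rw [isLittleO_one_iff]
    simpa using h.sub_const c

lemma const (c : ℝ) : HasLeadingTerm 0 (fun _ => c) fun _ => c := of_tendsto tendsto_const_nhds

variable {n k : ℕ} {f f' g g' : ℝ × ℝ → ℝ}

lemma isBigO (h : HasLeadingTerm n f g) : f =O[𝓝 0] fun z : ℝ × ℝ => ‖z‖ ^ n := by
  simpa using h.1.add h.2.isBigO

lemma add (h : HasLeadingTerm n f g) (h' : HasLeadingTerm n f' g') :
    HasLeadingTerm n (fun z => f z + f' z) fun z => g z + g' z :=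
  ⟨h.1.add h'.1, (h.2.add h'.2).congr_left fun z => by ring⟩

lemma sub (h : HasLeadingTerm n f g) (h' : HasLeadingTerm n f' g') :
    HasLeadingTerm n (fun z => f z - f' z) fun z => g z - g' z :=
  ⟨h.1.sub h'.1, (h.2.sub h'.2).congr_left fun z => by ring⟩

lemma sum {F G : Fin 3 → ℝ × ℝ → ℝ} (h : ∀ l, HasLeadingTerm n (F l) (G l)) :
    HasLeadingTerm n (fun z => ∑ l, F l z) fun z => ∑ l, G l z :=
  ⟨IsBigO.fun_sum fun l _ => (h l).1,
    (IsLittleO.fun_sum (s := Finset.univ) fun l _ => (h l).2).congr_left fun z => by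
      rw [Finset.sum_sub_distrib]⟩

lemma mul (h : HasLeadingTerm n f g) (h' : HasLeadingTerm k f' g') :
    HasLeadingTerm (n + k) (fun z => f z * f' z) fun z => g z * g' z := by
  simp only [HasLeadingTerm, pow_add]
  exact ⟨h.1.mul h'.1, ((h.isBigO.mul_isLittleO h'.2).add (h.2.mul_isBigO h'.1)).congr_left
    fun z => by ring⟩

lemma zero_mul (h : HasLeadingTerm 0 f g) (h' : HasLeadingTerm k f' g') :
    HasLeadingTerm k (fun z => f z * f' z) fun z => g z * g' z := by
  simpa only [Nat.zero_add] using h.mul h'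

lemma const_mul (c : ℝ) (h' : HasLeadingTerm k f' g') :
    HasLeadingTerm k (fun z => c * f' z) fun z => c * g' z := (const c).zero_mul h'

lemma congr (h : HasLeadingTerm n f g) (hf : f' =ᶠ[𝓝 0] f) (hg : ∀ z, g' z = g z) :
    HasLeadingTerm n f' g' := by
  obtain rfl : g' = g := funext hg
  exact ⟨h.1, h.2.congr' (hf.mono fun z hz => by simp only [hz]) EventuallyEq.rfl⟩

lemma comp_deriv {c : ℝ} (h : HasLeadingTerm 1 (fun z => f z - c) g) {φ : ℝ → ℝ} {φ' : ℝ}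
    (hφ : HasDerivAt φ φ' c) : HasLeadingTerm 1 (fun z => φ (f z) - φ c) fun z => φ' * g z := by
  have hlim : Tendsto f (𝓝 0) (𝓝 c) := by
    have h0 : Tendsto (fun z => f z - c) (𝓝 0) (𝓝 0) := h.isBigO.trans_tendsto (by
      simpa using (continuous_norm (E := ℝ × ℝ)).tendsto 0)
    simpa using h0.add_const c
  refine ⟨h.1.const_mul_left φ', ?_⟩
  have h1 := (hφ.isLittleO.comp_tendsto hlim).trans_isBigO h.isBigO
  refine (h1.add (h.2.const_mul_left φ')).congr_left fun z => ?_
  simp only [Function.comp, smul_eq_mul]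
  ring

end HasLeadingTerm

/-! ### Expansions at the equilateral triangle -/

/-- The unscaled triangle near the equilateral one. -/
noncomputable def baseTriangle (z : ℝ × ℝ) : Fin 3 → ℂ := ![-1, 1, ⟨z.1, Real.sqrt 3 + z.2⟩]

lemma nearEquilateral_eq (m : Fin 3 → ℝ) (z : ℝ × ℝ) :
    nearEquilateral m z = normalized m (baseTriangle z) := rfl

/-- Linear part of the half of the squared sides of `baseTriangle`. -/
noncomputable def sideForm (z : ℝ × ℝ) : Fin 3 → ℝ :=
  ![-z.1 + Real.sqrt 3 * z.2, z.1 + Real.sqrt 3 * z.2, 0]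

lemma side_baseTriangle_sq (z : ℝ × ℝ) (l : Fin 3) :
    side (baseTriangle z) l ^ 2 - 4 = 2 * sideForm z l
      + ![z.1 * z.1 + z.2 * z.2, z.1 * z.1 + z.2 * z.2, 0] l := by
  have h3 : Real.sqrt 3 * Real.sqrt 3 = 3 := Real.mul_self_sqrt (by norm_num)
  rw [side_sq]
  fin_cases l
  · simp [dot, edge, baseTriangle, sideForm]; linear_combination h3
  · simp [dot, edge, baseTriangle, sideForm]; linear_combination h3
  · simp [dot, edge, baseTriangle, sideForm]; norm_num

lemma rhoForm_eq (m : Fin 3 → ℝ) (z : ℝ × ℝ) : rhoForm m z =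
    ((m 0 * sideForm z 1 + m 1 * sideForm z 0) ^ 2
      + (m 1 * sideForm z 0 - m 2 * (sideForm z 1 - sideForm z 0)) ^ 2
      + (m 2 * (sideForm z 1 - sideForm z 0) + m 0 * sideForm z 1) ^ 2) / 2 := by
  have h3 : Real.sqrt 3 ^ 2 = 3 := Real.sq_sqrt (by norm_num)
  simp only [rhoForm, sideForm, Matrix.cons_val]
  linear_combination -m 0 * m 1 * z.2 ^ 2 * h3

lemma f₁Form_eq (m : Fin 3 → ℝ) (z : ℝ × ℝ) : f₁Form m z =
    m 0 * sideForm z 1 ^ 2 + m 1 * sideForm z 0 ^ 2 + m 2 * (sideForm z 1 - sideForm z 0) ^ 2 := by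
  simp only [f₁Form, sideForm, Matrix.cons_val]
  ring

/-- This is the sum of `rho_sq` at leading order: for equal sides the difference of squares in its
cross term is minus one squared side, which gives the plus sign here. -/
lemma sum_sideForm (m : Fin 3 → ℝ) (z : ℝ × ℝ) :
    ∑ l, m l * (m (l + 1) ^ 2 * (∑ k, pairMass m k * (sideForm z (l + 2) - sideForm z k)) ^ 2
      + m (l + 2) ^ 2 * (∑ k, pairMass m k * (sideForm z (l + 1) - sideForm z k)) ^ 2
      + m (l + 1) * m (l + 2) * (∑ k, pairMass m k * (sideForm z (l + 1) - sideForm z k))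
        * (∑ k, pairMass m k * (sideForm z (l + 2) - sideForm z k)))
      = massPairs m * (∏ k, m k) * rhoForm m z := by
  have h2 : sideForm z 2 = 0 := rfl
  rw [rhoForm_eq]
  simp only [Fin.sum_univ_three, Fin.prod_univ_three, massPairs, pairMass, h2,
    Fin.reduceAdd, zero_add]
  ring

lemma isBigO_fst : (fun z : ℝ × ℝ => z.1) =O[𝓝 0] fun z : ℝ × ℝ => ‖z‖ ^ 1 :=
  IsBigO.of_bound 1 (Eventually.of_forall fun z => by simpa using norm_fst_le z)

lemma isBigO_snd : (fun z : ℝ × ℝ => z.2) =O[𝓝 0] fun z : ℝ × ℝ => ‖z‖ ^ 1 :=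
  IsBigO.of_bound 1 (Eventually.of_forall fun z => by simpa using norm_snd_le z)

lemma isBigO_sideForm (l : Fin 3) :
    (fun z : ℝ × ℝ => sideForm z l) =O[𝓝 0] fun z : ℝ × ℝ => ‖z‖ ^ 1 := by
  fin_cases l
  · exact isBigO_fst.neg_left.add (isBigO_snd.const_mul_left _)
  · exact isBigO_fst.add (isBigO_snd.const_mul_left _)
  · exact isBigO_zero _ _

lemma hasLeadingTerm_side_baseTriangle (l : Fin 3) :
    HasLeadingTerm 1 (fun z => side (baseTriangle z) l ^ 2 - 4) fun z => 2 * sideForm z l := by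
  refine ⟨(isBigO_sideForm l).const_mul_left 2, ?_⟩
  simp only [side_baseTriangle_sq, add_sub_cancel_left]
  have h1 : (fun z : ℝ × ℝ => z.1 * z.1 + z.2 * z.2) =o[𝓝 0] fun z : ℝ × ℝ => ‖z‖ ^ 1 := by
    have hx : (fun z : ℝ × ℝ => z.1) =o[𝓝 0] fun _ : ℝ × ℝ => (1 : ℝ) := by
      rw [isLittleO_one_iff]; exact continuous_fst.tendsto (0 : ℝ × ℝ)
    have hy : (fun z : ℝ × ℝ => z.2) =o[𝓝 0] fun _ : ℝ × ℝ => (1 : ℝ) := by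
      rw [isLittleO_one_iff]; exact continuous_snd.tendsto (0 : ℝ × ℝ)
    simpa using (hx.mul_isBigO isBigO_fst).add (hy.mul_isBigO isBigO_snd)
  fin_cases l
  · exact h1
  · exact h1
  · exact isLittleO_zero _ _

lemma tendsto_side_baseTriangle (l : Fin 3) :
    Tendsto (fun z => side (baseTriangle z) l ^ 2) (𝓝 0) (𝓝 4) := by
  have h0 : Tendsto (fun z => side (baseTriangle z) l ^ 2 - 4) (𝓝 0) (𝓝 0) :=
    (hasLeadingTerm_side_baseTriangle l).isBigO.trans_tendsto (by
      simpa using (continuous_norm (E := ℝ × ℝ)).tendsto 0)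
  simpa using h0.add_const 4

lemma tendsto_centralInertia {m : Fin 3 → ℝ} (hm : ∀ k, 0 < m k) :
    Tendsto (fun z => centralInertia m (baseTriangle z)) (𝓝 0)
      (𝓝 (4 * (massPairs m / totalMass m))) := by
  have hM := totalMass_pos hm
  have h : (fun z => centralInertia m (baseTriangle z))
      = fun z => (∑ l, pairMass m l * side (baseTriangle z) l ^ 2) / totalMass m := by
    funext z
    rw [← totalMass_mul_centralInertia hM.ne', mul_div_cancel_left₀ _ hM.ne']
  rw [h]
  convert (tendsto_finsetSum Finset.univ fun l _ =>
    (tendsto_side_baseTriangle l).const_mul (pairMass m l)).div_const (totalMass m) using 2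
  rw [← Finset.sum_mul]
  simp only [massPairs, pairMass]
  ring

lemma eventually_nearEquilateral {m : Fin 3 → ℝ} (hm : ∀ k, 0 < m k) : ∀ᶠ z in 𝓝 (0 : ℝ × ℝ),
    0 < centralInertia m (baseTriangle z) ∧ inertia m (nearEquilateral m z) = 1 ∧
      (∀ l, 0 < side (baseTriangle z) l) ∧ ∀ l, 0 < side (nearEquilateral m z) l := by
  have hM := totalMass_pos hm
  have hσ := massPairs_pos hm
  have h1 := (tendsto_centralInertia hm).eventually_const_lt (show (0 : ℝ) < _ by positivity)
  have h2 : ∀ᶠ z in 𝓝 (0 : ℝ × ℝ), ∀ l, 0 < side (baseTriangle z) l ^ 2 :=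
    eventually_all.2 fun l =>
      (tendsto_side_baseTriangle l).eventually_const_lt (by norm_num)
  filter_upwards [h1, h2] with z hz1 hz2
  have hs : ∀ l, 0 < side (baseTriangle z) l := fun l =>
    lt_of_le_of_ne (side_nonneg _ l) fun h => by simpa [← h] using hz2 l
  refine ⟨hz1, inertia_normalized hz1, hs, fun l => ?_⟩
  rw [nearEquilateral_eq, side_normalized]
  exact div_pos (hs l) (Real.sqrt_pos.2 hz1)

lemma tendsto_side_sq {m : Fin 3 → ℝ} (hm : ∀ k, 0 < m k) (l : Fin 3) :
    Tendsto (fun z => side (nearEquilateral m z) l ^ 2) (𝓝 0)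
      (𝓝 (totalMass m / massPairs m)) := by
  have hM := totalMass_pos hm
  have hσ := massPairs_pos hm
  have h1 : Tendsto (fun z => side (baseTriangle z) l ^ 2 / centralInertia m (baseTriangle z))
      (𝓝 0) (𝓝 (4 / (4 * (massPairs m / totalMass m)))) :=
    (tendsto_side_baseTriangle l).div (tendsto_centralInertia hm) (by positivity)
  have h2 : 4 / (4 * (massPairs m / totalMass m)) = totalMass m / massPairs m := by field_simp
  rw [h2] at h1
  refine h1.congr' ?_
  filter_upwards [eventually_nearEquilateral hm] with z hz
  rw [nearEquilateral_eq, side_normalized, div_pow, Real.sq_sqrt hz.1.le]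

lemma tendsto_one_div_side {m : Fin 3 → ℝ} (hm : ∀ k, 0 < m k) (l : Fin 3) (b : ℝ) :
    Tendsto (fun z => 1 / side (nearEquilateral m z) l ^ b) (𝓝 0)
      (𝓝 ((massPairs m / totalMass m) ^ (b / 2))) := by
  have hM := totalMass_pos hm
  have hσ := massPairs_pos hm
  simp only [one_div_side_rpow, ← side_sq]
  have h := (tendsto_side_sq hm l).rpow_const (p := -b / 2)
    (Or.inl (show totalMass m / massPairs m ≠ 0 by positivity))
  convert h using 2
  rw [← inv_div, Real.inv_rpow (by positivity), ← Real.rpow_neg (by positivity)]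
  congr 1; ring

lemma weight_nearEquilateral (m : Fin 3 → ℝ) (a : ℝ) {z : ℝ × ℝ}
    (h : 0 < centralInertia m (baseTriangle z)) (l : Fin 3) : weight a (nearEquilateral m z) l
      = centralInertia m (baseTriangle z) ^ ((a + 2) / 2)
        * (side (baseTriangle z) l ^ 2) ^ (-(a + 2) / 2) := by
  rw [weight, one_div_side_rpow, ← side_sq, nearEquilateral_eq, side_normalized, div_pow,
    Real.sq_sqrt h.le, Real.div_rpow (sq_nonneg _) h.le, neg_div, Real.rpow_neg h.le, div_inv_eq_mul,
    mul_comm]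

/-- Normalization multiplies all weights by the same factor, so only the limit of that factor enters
a difference. The first order comes from the derivative of `s ^ (-(a+2)/2)` at the squared side 4.
-/
lemma hasLeadingTerm_weight_sub {m : Fin 3 → ℝ} (hm : ∀ k, 0 < m k) (a : ℝ) (k l : Fin 3) :
    HasLeadingTerm 1
      (fun z => weight a (nearEquilateral m z) k - weight a (nearEquilateral m z) l)
      fun z => (a + 2) / 4 * ((massPairs m / totalMass m) ^ (a / 2)
        * (massPairs m / totalMass m)) * (sideForm z l - sideForm z k) := by
  have hM := totalMass_pos hm
  have hσ := massPairs_pos hm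
  have hφ : HasDerivAt (fun s : ℝ => s ^ (-(a + 2) / 2)) _ 4 :=
    Real.hasDerivAt_rpow_const (p := -(a + 2) / 2) (Or.inl (by norm_num))
  have hV := fun l => (hasLeadingTerm_side_baseTriangle l).comp_deriv hφ
  have hK := HasLeadingTerm.of_tendsto ((tendsto_centralInertia hm).rpow_const (p := (a + 2) / 2)
    (Or.inl (by positivity)))
  refine (hK.zero_mul ((hV k).sub (hV l))).congr ?_ fun z => ?_
  · filter_upwards [eventually_nearEquilateral hm] with z hz
    rw [weight_nearEquilateral m a hz.1, weight_nearEquilateral m a hz.1]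
    ring
  · have ht : 0 < massPairs m / totalMass m := by positivity
    have h4 : (4 : ℝ) ^ (-(a + 2) / 2 - 1) = ((4 : ℝ) ^ ((a + 2) / 2))⁻¹ / 4 := by
      rw [Real.rpow_sub_one (by norm_num), neg_div, Real.rpow_neg (by norm_num)]
    have h5 : (massPairs m / totalMass m) ^ ((a + 2) / 2)
        = (massPairs m / totalMass m) ^ (a / 2) * (massPairs m / totalMass m) := by
      rw [← Real.rpow_add_one ht.ne']; congr 1; ring
    rw [Real.mul_rpow (by norm_num) ht.le, h4, h5]
    have h6 : (4 : ℝ) ^ ((a + 2) / 2) ≠ 0 := (Real.rpow_pos_of_pos (by norm_num) _).ne'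
    field_simp
    ring

lemma hasLeadingTerm_deviation {m : Fin 3 → ℝ} (hm : ∀ k, 0 < m k) (a : ℝ) (l : Fin 3) :
    HasLeadingTerm 1 (fun z => deviation a m (nearEquilateral m z) l)
      fun z => (a + 2) / 4 * ((massPairs m / totalMass m) ^ (a / 2)
        * (1 / totalMass m)) * ∑ k, pairMass m k * (sideForm z l - sideForm z k) := by
  have hM := totalMass_pos hm
  have hσ := massPairs_pos hm
  refine (HasLeadingTerm.const_mul (1 / totalMass m) (HasLeadingTerm.sum fun k =>
    ((HasLeadingTerm.of_tendsto (tendsto_side_sq hm k)).zero_mul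
      (hasLeadingTerm_weight_sub hm a k l)).const_mul (pairMass m k))).congr
      (Eventually.of_forall fun z => rfl) fun z => ?_
  rw [Finset.mul_sum, Finset.mul_sum]
  refine Finset.sum_congr rfl fun k _ => ?_
  field_simp

lemma hasLeadingTerm_rho_sq {m : Fin 3 → ℝ} (hm : ∀ k, 0 < m k) {a : ℝ} (ha : 0 < a) :
    HasLeadingTerm 2 (fun z => rho a m (nearEquilateral m z) ^ 2)
      fun z => ((a + 2) * (∏ k, m k) / (4 * totalMass m)) ^ 2
          * (massPairs m / totalMass m) ^ a * rhoForm m z := by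
  have hM := totalMass_pos hm
  have hσ := massPairs_pos hm
  have hs := fun l => HasLeadingTerm.of_tendsto (tendsto_side_sq hm l)
  have he := hasLeadingTerm_deviation hm a
  refine (HasLeadingTerm.const_mul ((∏ k, m k) / totalMass m) (HasLeadingTerm.sum fun k =>
    (((((hs (k + 2)).const_mul (m (k + 1) ^ 2)).zero_mul ((he (k + 2)).mul (he (k + 2)))).add
    (((hs (k + 1)).const_mul (m (k + 2) ^ 2)).zero_mul ((he (k + 1)).mul (he (k + 1))))).sub
    (((((hs k).sub (hs (k + 1))).sub (hs (k + 2))).const_mul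
      (m (k + 1) * m (k + 2))).zero_mul ((he (k + 1)).mul (he (k + 2))))).const_mul (m k))).congr
    ?_ fun z => ?_
  · filter_upwards [eventually_nearEquilateral hm] with z hz
    exact rho_sq ha hm (centre_normalized hM.ne' _) hz.2.1 hz.2.2.2
  · have ht : 0 < massPairs m / totalMass m := by positivity
    have h2 : (massPairs m / totalMass m) ^ a = ((massPairs m / totalMass m) ^ (a / 2)) ^ 2 := by
      rw [← Real.rpow_natCast, ← Real.rpow_mul ht.le]; congr 1; push_cast; ring
    rw [h2]
    generalize (massPairs m / totalMass m) ^ (a / 2) = P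
    have key := sum_sideForm m z
    obtain ⟨E, hE⟩ : ∃ E : Fin 3 → ℝ,
        ∀ l, ∑ k, pairMass m k * (sideForm z l - sideForm z k) = E l := ⟨_, fun _ => rfl⟩
    simp only [hE] at key ⊢
    -- Prepares the factor `massPairs m * (∏ k, m k) * rhoForm m z`, to which `sum_sideForm`
    -- applies.
    have h3 : ((a + 2) * (∏ k, m k) / (4 * totalMass m)) ^ 2 * P ^ 2 * rhoForm m z
        = (∏ k, m k) / massPairs m * ((a + 2) / 4 * (P * (1 / totalMass m))) ^ 2
          * (massPairs m * (∏ k, m k) * rhoForm m z) := by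
      field_simp
    rw [h3, ← key]
    simp only [Fin.sum_univ_three]
    field_simp
    ring

lemma tendsto_area2_sq {m : Fin 3 → ℝ} (hm : ∀ k, 0 < m k) :
    Tendsto (fun z => area2 (nearEquilateral m z) ^ 2) (𝓝 0)
      (𝓝 (3 / 4 * (totalMass m / massPairs m) ^ 2)) := by
  have hs := tendsto_side_sq hm
  simp only [area2_sq]
  convert ((hs 0).mul (hs 1)).sub (((((hs 2).sub (hs 0)).sub (hs 1)).pow 2).const_mul (1 / 4))
    using 2
  ring

lemma hasLeadingTerm_f₁ {m : Fin 3 → ℝ} (hm : ∀ k, 0 < m k) (a : ℝ) :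
    HasLeadingTerm 2 (fun z => f₁ a m (nearEquilateral m z))
      fun z => ((a + 2) * (∏ k, m k) / (4 * totalMass m)) ^ 2
          * (massPairs m / totalMass m) ^ a *
          (3 * (a + 2) * massPairs m ^ 2 / (4 * ∏ k, m k)
            * (massPairs m / totalMass m) ^ (a / 2) * f₁Form m z) := by
  have hM := totalMass_pos hm
  have hσ := massPairs_pos hm
  have hP : 0 < ∏ k, m k := Finset.prod_pos fun k _ => hm k
  have hA := HasLeadingTerm.of_tendsto (tendsto_area2_sq hm)
  have hr := fun l => HasLeadingTerm.of_tendsto (tendsto_one_div_side hm l (a + 4))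
  have hw := hasLeadingTerm_weight_sub hm a
  refine ((hA.const_mul ((a + 2) * ∏ k, m k)).zero_mul (HasLeadingTerm.sum fun l =>
    ((hr l).const_mul (m l)).zero_mul ((hw (l + 1) (l + 2)).mul (hw (l + 1) (l + 2))))).congr
    (Eventually.of_forall fun z => ?_) fun z => ?_
  · simp only [f₁, weight, mul_one_div, pow_two]
  · have ht : 0 < massPairs m / totalMass m := by positivity
    have h2 : (massPairs m / totalMass m) ^ a = ((massPairs m / totalMass m) ^ (a / 2)) ^ 2 := by
      rw [← Real.rpow_natCast, ← Real.rpow_mul ht.le]; congr 1; push_cast; ring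
    have h4 : (massPairs m / totalMass m) ^ ((a + 4) / 2)
        = (massPairs m / totalMass m) ^ (a / 2) * (massPairs m / totalMass m) ^ 2 := by
      rw [← Real.rpow_two, ← Real.rpow_add ht]; congr 1; ring
    rw [h2, h4]
    generalize (massPairs m / totalMass m) ^ (a / 2) = P
    simp only [Fin.sum_univ_three, sideForm, f₁Form, Fin.reduceAdd, zero_add, Matrix.cons_val]
    field_simp
    ring

/-- Let `P` be the common limit of the weights. Both `2aμ` and the sum subtracted from it tend to
`2MP`, the first because the squared sides tend to `M/σ`. -/
lemma tendsto_f₂ {m : Fin 3 → ℝ} (hm : ∀ k, 0 < m k) {a : ℝ} (ha : 0 < a) :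
    Tendsto (fun z => f₂ a m (nearEquilateral m z)) (𝓝 0) (𝓝 0) := by
  have hM := totalMass_pos hm
  have hσ := massPairs_pos hm
  have hs := tendsto_side_sq hm
  have hu := fun l => tendsto_one_div_side hm l (a + 2)
  have h := (((tendsto_finsetSum Finset.univ fun l _ =>
    ((hu l).mul (hs l)).const_mul (pairMass m l)).const_mul 2).sub
      (tendsto_finsetSum Finset.univ fun l _ => (hu l).const_mul (m (l + 1) + m (l + 2)))).const_mul
      (totalMass m / ∏ k, m k)
  refine Tendsto.congr' ?_ (h.trans_eq ?_)
  · filter_upwards [eventually_nearEquilateral hm] with z hz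
    rw [f₂, mul_assoc 2 a, mul_confMeasure ha hz.2.1 hz.2.2.2]
    simp only [weight, mul_one_div]
  · congr 1
    generalize (massPairs m / totalMass m) ^ ((a + 2) / 2) = P
    rw [← Finset.sum_mul, ← Finset.sum_mul]
    have h1 : ∑ l, pairMass m l = massPairs m := rfl
    have h2 : ∑ l : Fin 3, (m (l + 1) + m (l + 2)) = 2 * totalMass m := by
      simp only [Fin.sum_univ_three, totalMass, Fin.reduceAdd, zero_add]; ring
    rw [h1, h2]
    field_simp
    ring

/-! ### Comparison of the two quadratic forms -/

/-- The difference is an explicit sum of squares with positive coefficients. It gives the upper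
bound of the directional limit and, with `norm_sq_le_f₁Form`, the definiteness of `rhoForm`. -/
lemma massPairs_mul_f₁Form_le {m : Fin 3 → ℝ} (hm : ∀ k, 0 < m k) (z : ℝ × ℝ) :
    massPairs m * f₁Form m z ≤ 2 * totalMass m * rhoForm m z := by
  have h0 := hm 0
  have h1 := hm 1
  have h2 := hm 2
  rw [f₁Form_eq, rhoForm_eq]
  generalize sideForm z 0 = x
  generalize sideForm z 1 = y
  simp only [massPairs, totalMass, Fin.sum_univ_three, Fin.reduceAdd, zero_add]
  have e : 2 * (m 0 + m 1 + m 2) * (((m 0 * y + m 1 * x) ^ 2 + (m 1 * x - m 2 * (y - x)) ^ 2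
      + (m 2 * (y - x) + m 0 * y) ^ 2) / 2)
      - (m 1 * m 2 + m 2 * m 0 + m 0 * m 1) * (m 0 * y ^ 2 + m 1 * x ^ 2 + m 2 * (y - x) ^ 2)
      = (m 0 + m 1) * (m 0 * y + m 1 * x) ^ 2 + (m 1 + m 2) * (m 1 * x - m 2 * (y - x)) ^ 2
        + (m 0 + m 2) * (m 2 * (y - x) + m 0 * y) ^ 2 := by ring
  rw [← sub_nonneg, e]
  positivity

lemma rhoForm_le {m : Fin 3 → ℝ} (hm : ∀ k, 0 < m k) (z : ℝ × ℝ) :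
    rhoForm m z ≤ 3 / 2 * totalMass m * f₁Form m z := by
  have h0 := hm 0
  have h1 := hm 1
  have h2 := hm 2
  rw [f₁Form_eq, rhoForm_eq]
  generalize sideForm z 0 = x
  generalize sideForm z 1 = y
  simp only [totalMass, Fin.sum_univ_three]
  have e : 3 / 2 * (m 0 + m 1 + m 2) * (m 0 * y ^ 2 + m 1 * x ^ 2 + m 2 * (y - x) ^ 2)
      - ((m 0 * y + m 1 * x) ^ 2 + (m 1 * x - m 2 * (y - x)) ^ 2
      + (m 2 * (y - x) + m 0 * y) ^ 2) / 2
      = 3 / 2 * (m 0 * (m 1 + m 2) * y ^ 2 + m 1 * (m 0 + m 2) * x ^ 2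
        + m 2 * (m 0 + m 1) * (y - x) ^ 2)
        + (m 0 * y - m 1 * x - m 2 * (y - x)) ^ 2 / 2 := by ring
  rw [← sub_nonneg, e]
  positivity

lemma norm_sq_le_add_sq (z : ℝ × ℝ) : ‖z‖ ^ 2 ≤ z.1 ^ 2 + z.2 ^ 2 := by
  rw [Prod.norm_def]
  rcases max_choice ‖z.1‖ ‖z.2‖ with h | h <;> rw [h, Real.norm_eq_abs, sq_abs] <;>
    nlinarith [sq_nonneg z.1, sq_nonneg z.2]

lemma norm_sq_le_f₁Form {m : Fin 3 → ℝ} (hm : ∀ k, 0 < m k) (z : ℝ × ℝ) :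
    2 * min (m 0) (m 1) * ‖z‖ ^ 2 ≤ f₁Form m z := by
  have h3 : Real.sqrt 3 ^ 2 = 3 := Real.sq_sqrt (by norm_num)
  have h0 : min (m 0) (m 1) ≤ m 0 := min_le_left _ _
  have h1 : min (m 0) (m 1) ≤ m 1 := min_le_right _ _
  have hmin : 0 < min (m 0) (m 1) := lt_min (hm 0) (hm 1)
  have hz := norm_sq_le_add_sq z
  have e : sideForm z 1 ^ 2 + sideForm z 0 ^ 2 = 2 * z.1 ^ 2 + 6 * z.2 ^ 2 := by
    simp only [sideForm, Matrix.cons_val]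
    linear_combination 2 * z.2 ^ 2 * h3
  calc 2 * min (m 0) (m 1) * ‖z‖ ^ 2
      ≤ min (m 0) (m 1) * (sideForm z 1 ^ 2 + sideForm z 0 ^ 2) := by
        rw [e]; nlinarith [sq_nonneg z.2, mul_nonneg hmin.le (sq_nonneg z.2)]
    _ ≤ m 0 * sideForm z 1 ^ 2 + m 1 * sideForm z 0 ^ 2 := by
        nlinarith [sq_nonneg (sideForm z 1), sq_nonneg (sideForm z 0)]
    _ ≤ f₁Form m z := by
        rw [f₁Form_eq]
        nlinarith [mul_nonneg (hm 2).le (sq_nonneg (sideForm z 1 - sideForm z 0))]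

lemma f₁Form_pos {m : Fin 3 → ℝ} (hm : ∀ k, 0 < m k) {z : ℝ × ℝ} (hz : z ≠ 0) :
    0 < f₁Form m z := by
  have := norm_pos_iff.2 hz
  have hmin : 0 < min (m 0) (m 1) := lt_min (hm 0) (hm 1)
  exact lt_of_lt_of_le (by positivity) (norm_sq_le_f₁Form hm z)

lemma rhoForm_pos {m : Fin 3 → ℝ} (hm : ∀ k, 0 < m k) {z : ℝ × ℝ} (hz : z ≠ 0) :
    0 < rhoForm m z := by
  have h := massPairs_mul_f₁Form_le hm z
  have h1 := mul_pos (massPairs_pos hm) (f₁Form_pos hm hz)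
  have hM := totalMass_pos hm
  exact (pos_iff_pos_of_mul_pos (h1.trans_le h)).1 (by positivity)

lemma isBigO_rhoForm {m : Fin 3 → ℝ} (hm : ∀ k, 0 < m k) :
    (fun z : ℝ × ℝ => ‖z‖ ^ 2) =O[𝓝 0] rhoForm m := by
  have hmin : 0 < min (m 0) (m 1) := lt_min (hm 0) (hm 1)
  have hM := totalMass_pos hm
  have hσ := massPairs_pos hm
  refine IsBigO.of_bound (2 * totalMass m / (massPairs m * (2 * min (m 0) (m 1))))
    (Eventually.of_forall fun z => ?_)
  rw [norm_pow, norm_norm, div_mul_eq_mul_div, le_div_iff₀ (by positivity)]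
  have h1 := massPairs_mul_f₁Form_le hm z
  have h2 := mul_le_mul_of_nonneg_left (norm_sq_le_f₁Form hm z) hσ.le
  have h3 := mul_le_mul_of_nonneg_left (le_abs_self (rhoForm m z))
    (show 0 ≤ 2 * totalMass m by positivity)
  rw [Real.norm_eq_abs]
  linarith

lemma dirLimit_bounds {a : ℝ} (ha : 0 < a) {m : Fin 3 → ℝ} (hm : ∀ k, 0 < m k) :
    ∃ c c' : ℝ, 0 < c ∧ ∀ z : ℝ × ℝ, z ≠ 0 → c ≤ dirLimit a m z ∧ dirLimit a m z ≤ c' := by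
  have hM := totalMass_pos hm
  have hσ := massPairs_pos hm
  have hP : 0 < ∏ k, m k := Finset.prod_pos fun k _ => hm k
  have hA : 0 < 3 * (a + 2) * massPairs m ^ 2 / (4 * ∏ k, m k)
      * (massPairs m / totalMass m) ^ (a / 2) :=
    mul_pos (by positivity) (Real.rpow_pos_of_pos (by positivity) _)
  unfold dirLimit
  generalize 3 * (a + 2) * massPairs m ^ 2 / (4 * ∏ k, m k)
      * (massPairs m / totalMass m) ^ (a / 2) = A at hA ⊢
  refine ⟨A * (2 / (3 * totalMass m)), A * (2 * totalMass m / massPairs m), by positivity,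
    fun z hz => ⟨?_, ?_⟩⟩
  · refine mul_le_mul_of_nonneg_left ?_ hA.le
    rw [div_le_div_iff₀ (by positivity) (rhoForm_pos hm hz)]
    linarith [rhoForm_le hm z]
  · refine mul_le_mul_of_nonneg_left ?_ hA.le
    rw [div_le_div_iff₀ (rhoForm_pos hm hz) hσ]
    linarith [massPairs_mul_f₁Form_le hm z]

/-! ### Directional limits and the key condition -/

/-- Coefficient of the leading term of `ρ²`. -/
noncomputable def rhoCoeff (a : ℝ) (m : Fin 3 → ℝ) : ℝ :=
  ((a + 2) * (∏ k, m k) / (4 * totalMass m)) ^ 2 * (massPairs m / totalMass m) ^ a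

lemma rhoCoeff_pos {a : ℝ} (ha : 0 < a) {m : Fin 3 → ℝ} (hm : ∀ k, 0 < m k) :
    0 < rhoCoeff a m := by
  have hM := totalMass_pos hm
  have hσ := massPairs_pos hm
  have hP : 0 < ∏ k, m k := Finset.prod_pos fun k _ => hm k
  exact mul_pos (by positivity) (Real.rpow_pos_of_pos (by positivity) _)

lemma HasLeadingTerm.tendsto_sub_div {f g h : ℝ × ℝ → ℝ} (hf : HasLeadingTerm 2 f g)
    (hh : (fun z : ℝ × ℝ => ‖z‖ ^ 2) =O[𝓝 0] h) :
    Tendsto (fun z => (f z - g z) / h z) (𝓝[≠] 0) (𝓝 0) :=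
  (hf.2.trans_isBigO hh).tendsto_div_nhds_zero.mono_left nhdsWithin_le_nhds

lemma isBigO_rhoCoeff_mul {a : ℝ} (ha : 0 < a) {m : Fin 3 → ℝ} (hm : ∀ k, 0 < m k) :
    (fun z : ℝ × ℝ => ‖z‖ ^ 2) =O[𝓝 0] fun z => rhoCoeff a m * rhoForm m z :=
  (isBigO_rhoForm hm).trans (isBigO_self_const_mul (rhoCoeff_pos ha hm).ne' _ _)

lemma tendsto_rho_sq_div {a : ℝ} (ha : 0 < a) {m : Fin 3 → ℝ} (hm : ∀ k, 0 < m k) :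
    Tendsto (fun z => rho a m (nearEquilateral m z) ^ 2 / (rhoCoeff a m * rhoForm m z)) (𝓝[≠] 0)
      (𝓝 1) := by
  have h := ((hasLeadingTerm_rho_sq hm ha).tendsto_sub_div
    (isBigO_rhoCoeff_mul ha hm)).add_const 1
  rw [zero_add] at h
  refine h.congr' ?_
  filter_upwards [self_mem_nhdsWithin] with z hz
  have := (mul_pos (rhoCoeff_pos ha hm) (rhoForm_pos hm hz)).ne'
  rw [div_add_one this]
  simp only [rhoCoeff, sub_add_cancel]

lemma eventually_rho_pos {a : ℝ} (ha : 0 < a) {m : Fin 3 → ℝ} (hm : ∀ k, 0 < m k) :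
    ∀ᶠ z in 𝓝[≠] 0, 0 < rho a m (nearEquilateral m z) := by
  filter_upwards [(tendsto_rho_sq_div ha hm).eventually_const_lt one_pos] with z hz
  refine lt_of_le_of_ne (Real.sqrt_nonneg _) fun h => ?_
  rw [← h] at hz
  simp at hz

lemma tendsto_rho {a : ℝ} (ha : 0 < a) {m : Fin 3 → ℝ} (hm : ∀ k, 0 < m k) :
    Tendsto (fun z => rho a m (nearEquilateral m z)) (𝓝 0) (𝓝 0) := by
  have h1 : Tendsto (fun z => rho a m (nearEquilateral m z) ^ 2) (𝓝 0) (𝓝 0) :=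
    (hasLeadingTerm_rho_sq hm ha).isBigO.trans_tendsto (by
      have hn : Continuous fun z : ℝ × ℝ => ‖z‖ ^ 2 := by fun_prop
      simpa using hn.tendsto 0)
  have h2 := h1.sqrt
  rw [Real.sqrt_zero] at h2
  exact h2.congr fun z => Real.sqrt_sq (Real.sqrt_nonneg _)

/-- Write `L` for `dirLimit` and `bD` for the leading term of `ρ²`; that of `f₁` is `bDL`. Since `L`
is bounded and `ρ²/(bD)` tends to 1, both `(f₁ - bDL)/(bD)` and `L (ρ²/(bD) - 1)` tend to zero.
Their difference divided by `ρ²/(bD)` is `f₁/ρ² - L`. -/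
lemma tendsto_sub_dirLimit {a : ℝ} (ha : 0 < a) {m : Fin 3 → ℝ} (hm : ∀ k, 0 < m k) :
    Tendsto (fun z => f₁ a m (nearEquilateral m z) / rho a m (nearEquilateral m z) ^ 2
      + f₂ a m (nearEquilateral m z) - dirLimit a m z) (𝓝[≠] 0) (𝓝 0) := by
  obtain ⟨c, c', hc, hL⟩ := dirLimit_bounds ha hm
  have h1 := (hasLeadingTerm_f₁ hm a).tendsto_sub_div (isBigO_rhoCoeff_mul ha hm)
  have h2 := tendsto_rho_sq_div ha hm
  have h3 : Tendsto (fun z => dirLimit a m z * (rho a m (nearEquilateral m z) ^ 2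
      / (rhoCoeff a m * rhoForm m z) - 1)) (𝓝[≠] 0) (𝓝 0) := by
    have h4 := ((h2.sub_const 1).norm).const_mul c'
    rw [sub_self, norm_zero, mul_zero] at h4
    refine squeeze_zero_norm' ?_ h4
    filter_upwards [self_mem_nhdsWithin] with z hz
    obtain ⟨hl, hu⟩ := hL z hz
    rw [norm_mul, Real.norm_of_nonneg (hc.le.trans hl)]
    exact mul_le_mul_of_nonneg_right hu (norm_nonneg _)
  have h5 := ((h1.sub h3).div h2 one_ne_zero).add
    ((tendsto_f₂ hm ha).mono_left (nhdsWithin_le_nhds (s := {0}ᶜ)))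
  rw [sub_self, zero_div, add_zero] at h5
  refine h5.congr' ?_
  filter_upwards [self_mem_nhdsWithin, eventually_rho_pos ha hm] with z hz hρ
  have hD := rhoForm_pos hm hz
  have hb := rhoCoeff_pos ha hm
  have hlead : ((a + 2) * (∏ k, m k) / (4 * totalMass m)) ^ 2
          * (massPairs m / totalMass m) ^ a *
          (3 * (a + 2) * massPairs m ^ 2 / (4 * ∏ k, m k)
            * (massPairs m / totalMass m) ^ (a / 2) * f₁Form m z)
      = rhoCoeff a m * rhoForm m z * dirLimit a m z := by
    rw [dirLimit, rhoCoeff]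
    generalize 3 * (a + 2) * massPairs m ^ 2 / (4 * ∏ k, m k)
      * (massPairs m / totalMass m) ^ (a / 2) = A
    generalize ((a + 2) * (∏ k, m k) / (4 * totalMass m)) ^ 2
          * (massPairs m / totalMass m) ^ a = b
    field_simp
  simp only [Pi.div_apply, hlead]
  field_simp
  ring

lemma tendsto_rho_sq_mul_keyRHS {a : ℝ} (ha : 0 < a) {m : Fin 3 → ℝ} (hm : ∀ k, 0 < m k)
    (C β ε : ℝ) :
    Tendsto (fun z : ℝ × ℝ =>
      rho a m (nearEquilateral m z) ^ 2 * keyRHS a m C β ε (nearEquilateral m z)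
        - (∏ k, m k) ^ 2 / totalMass m ^ 2 * β * dirLimit a m z) (𝓝[≠] 0) (𝓝 0) := by
  have h := ((tendsto_sub_dirLimit ha hm).const_mul
    ((∏ k, m k) ^ 2 / totalMass m ^ 2 * β)).add
    (((tendsto_rho ha hm).mono_left (nhdsWithin_le_nhds (s := {0}ᶜ))).const_mul
      (2 * ε * C * Real.sqrt ((∏ k, m k) / totalMass m * β)))
  rw [mul_zero, mul_zero, add_zero] at h
  refine h.congr' ?_
  filter_upwards [eventually_rho_pos ha hm] with z hρ
  rw [keyRHS]
  generalize (∏ k, m k) ^ 2 / totalMass m ^ 2 * β = A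
  generalize Real.sqrt ((∏ k, m k) / totalMass m * β) = S
  field_simp
  ring

lemma tendsto_keyRHS {a : ℝ} (ha : 0 < a) {m : Fin 3 → ℝ} (hm : ∀ k, 0 < m k)
    (C ε : ℝ) {β : ℝ} (hβ : 0 < β) :
    Tendsto (fun z : ℝ × ℝ => keyRHS a m C β ε (nearEquilateral m z)) (𝓝[≠] 0) atTop := by
  obtain ⟨c, c', hc, hL⟩ := dirLimit_bounds ha hm
  have hM := totalMass_pos hm
  have hP : 0 < ∏ k, m k := Finset.prod_pos fun k _ => hm k
  have hA : 0 < (∏ k, m k) ^ 2 / totalMass m ^ 2 * β := by positivity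
  have h := tendsto_rho_sq_mul_keyRHS ha hm C β ε
  set A := (∏ k, m k) ^ 2 / totalMass m ^ 2 * β with hAdef
  have hinv : Tendsto (fun z => (rho a m (nearEquilateral m z) ^ 2)⁻¹) (𝓝[≠] 0) atTop := by
    refine Tendsto.inv_tendsto_nhdsGT_zero (tendsto_nhdsWithin_iff.2 ⟨?_, ?_⟩)
    · simpa using ((tendsto_rho ha hm).mono_left (nhdsWithin_le_nhds (s := {0}ᶜ))).pow 2
    · filter_upwards [eventually_rho_pos ha hm] with z hρ
      exact pow_pos hρ 2
  -- Near the origin `ρ²R` exceeds `A L - A c / 2`, which is at least `A c / 2` because `L ≥ c`.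
  refine tendsto_atTop_mono' _ ?_ (hinv.const_mul_atTop (show 0 < A * c / 2 by positivity))
  filter_upwards [self_mem_nhdsWithin, eventually_rho_pos ha hm,
    h.eventually_const_lt (show -(A * c / 2) < 0 by linarith [mul_pos hA hc])] with z hz hρ hlt
  rw [← div_eq_mul_inv, div_le_iff₀ (by positivity)]
  have := mul_le_mul_of_nonneg_left (hL z hz).1 hA.le
  linarith

end ThreeBody

theorem theorem8 (a : ℝ) (ha : 0 < a) (m : Fin 3 → ℝ) (hm : ∀ k, 0 < m k) :
    -- no solutions of constant configurational measure near an equilateral triangle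
    (∀ I₀ C β : ℝ, 0 < I₀ → 0 < β →
      ∃ δ : ℝ, 0 < δ ∧
        ¬ ∃ (J : Set ℝ) (t₀ : ℝ) (q p : ℝ → Fin 3 → ℂ),
          IsOpen J ∧ J.OrdConnected ∧ t₀ ∈ J ∧
          ThreeBody.IsSolution a m J q p ∧
          (∃ μ : ℝ, ∀ t ∈ J, ThreeBody.confMeasure a m (q t) = μ) ∧
          ThreeBody.inertia m (q t₀) = I₀ ∧
          ThreeBody.angularMomentum (q t₀) (p t₀) = C ∧
          ThreeBody.constB a m q p t₀ - C ^ 2 = β ∧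
          ∃ e : Fin 3 → ℂ, ThreeBody.IsEquilateral e ∧ ∀ k, ‖q t₀ k - e k‖ < δ) ∧
    -- the leading quadratic form of `ρ²` is positive definite
    (∀ z : ℝ × ℝ, z ≠ 0 → 0 < ThreeBody.rhoForm m z) ∧
    ((fun z : ℝ × ℝ => ThreeBody.rho a m (ThreeBody.nearEquilateral m z) ^ 2
        - ((a + 2) * (∏ k, m k) / (4 * ThreeBody.totalMass m)) ^ 2
          * (ThreeBody.massPairs m / ThreeBody.totalMass m) ^ a * ThreeBody.rhoForm m z)
      =o[𝓝 0] fun z : ℝ × ℝ => z.1 ^ 2 + z.2 ^ 2) ∧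
    -- `f₁/ρ² + f₂` has positive finite limits, uniformly in the direction of approach
    (∃ c c' : ℝ, 0 < c ∧ ∀ z : ℝ × ℝ, z ≠ 0 →
      c ≤ ThreeBody.dirLimit a m z ∧ ThreeBody.dirLimit a m z ≤ c') ∧
    Tendsto (fun z : ℝ × ℝ =>
        ThreeBody.f₁ a m (ThreeBody.nearEquilateral m z)
            / ThreeBody.rho a m (ThreeBody.nearEquilateral m z) ^ 2
          + ThreeBody.f₂ a m (ThreeBody.nearEquilateral m z)
          - ThreeBody.dirLimit a m z) (𝓝[≠] 0) (𝓝 0) ∧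
    -- the right-hand side of the key condition blows up like `1/ρ²`
    (∀ C β ε : ℝ, 0 < β → (ε = 1 ∨ ε = -1) →
      Tendsto (fun z : ℝ × ℝ => ThreeBody.keyRHS a m C β ε (ThreeBody.nearEquilateral m z))
        (𝓝[≠] 0) atTop ∧
      Tendsto (fun z : ℝ × ℝ =>
          ThreeBody.rho a m (ThreeBody.nearEquilateral m z) ^ 2
              * ThreeBody.keyRHS a m C β ε (ThreeBody.nearEquilateral m z)
            - (∏ k, m k) ^ 2 / ThreeBody.totalMass m ^ 2 * β * ThreeBody.dirLimit a m z)
        (𝓝[≠] 0) (𝓝 0)) := by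
  refine ⟨fun I₀ C β hI₀ hβ => ?_, fun z hz => ThreeBody.rhoForm_pos hm hz, ?_,
    ThreeBody.dirLimit_bounds ha hm, ThreeBody.tendsto_sub_dirLimit ha hm, fun C β ε hβ _ =>
      ⟨ThreeBody.tendsto_keyRHS ha hm C ε hβ, ThreeBody.tendsto_rho_sq_mul_keyRHS ha hm C β ε⟩⟩
  · obtain ⟨δ, hδ, h⟩ := ThreeBody.exists_no_constant_measure (C := C) ha hm hI₀ hβ
    refine ⟨δ, hδ, ?_⟩
    rintro ⟨J, t₀, q, p, hJ, -, ht, hsol, ⟨μ, hμ⟩, rfl, rfl, rfl, e, he, hqe⟩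
    obtain ⟨w, hw, hw', hneg⟩ := ThreeBody.exists_isShapeVelocity ha hm hJ hsol hμ ht
    exact (h (q t₀) w e (hsol.centre t₀ ht) rfl hw hw' he hqe).not_ge hneg
  · refine (ThreeBody.hasLeadingTerm_rho_sq hm ha).2.trans_isBigO
      (IsBigO.of_bound 1 (Eventually.of_forall fun z => ?_))
    rw [one_mul, norm_pow, norm_norm, Real.norm_of_nonneg (by positivity)]
    exact ThreeBody.norm_sq_le_add_sq z
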